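/- Conventions. A computable metric space is a complete metric space $(X,d)$ with a dense sequence $(s_i)_{i\in\mathbb N}$ of ideal points such that the numbers $d(s_i,s_j)$ are computable reals uniformly in $i,j$ (that is, $\{(i,j,q):q<d(s_i,s_j)\}$ and $\{(i,j,q):q>d(s_i,s_j)\}$, $q\in\mathbb Q$, are r.e.). Its ideal balls are $B_{\langle i,j\rangle}=B(s_i,q_j)$, where $(q_j)$ is an effective numbering of the positive rationals. Sets $U_n$ are recursively open uniformly in $n$ if there is an r.e. set $E\subseteq\mathbb N^2$ with $U_n=\bigcup_{(n,i)\in E}B_i$ for all $n$. A function $T:X\to Y$ is computable on $C\subseteq X$ if there are $U_n\subseteq X$, recursively open uniformly in $n$, with $T^{-1}(B^Y_n)\cap C=U_n\cap C$ for all $n$; it is computable if $T^{-1}(U^Y_e)$ is recursively open uniformly in $e$, where $U^Y_e=\bigcup_{i\in E_e}B^Y_i$ and $E_e$ is the range of the $e$-th partial recursive function. If $X$ is bounded, the set $PM(X)$ of Borel probability measures on $X$ carries the distance $W_1(\mu,\nu)=\sup\{|\int f\,d\mu-\int f\,d\nu| : f:X\to\mathbb R \text{ 1-Lipschitz}\}$,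 and its ideal points are the finite rational convex combinations of Dirac measures $\delta_{s_i}$, effectively numbered. The transfer operator of $T:X\to X$ is $L_T\mu=T_*\mu$ (so $\int f\,dL_T\mu=\int f\circ T\,d\mu$ for bounded continuous $f$), which is defined whenever $T$ is $\mu$-almost everywhere measurable. Theorem 4.1. Let $X$ be a bounded computable metric space and $T:X\to X$ a function. (1) Let $D\subseteq X$ be any set. If $T$ is computable on $X\setminus D$, then $T$ is $\mu$-almost everywhere measurable for every $\mu\in PM_D(X)=\{\mu\in PM(X):\mu(D)=0\}$ (so that $L_T$ is defined on $PM_D(X)$), and $L_T$ is computable on $PM_D(X)$. (2) In particular, if $T$ is computable, then $T$ is Borel measurable and $L_T:PM(X)\to PM(X)$ is computable. -/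

import Mathlib

open MeasureTheory

noncomputable section

namespace CompAnalysis

/-! ### Numberings -/

/-- An effective numbering of the rational numbers: the number `⟨⟨a, b⟩, c⟩` names
`(a - b) / (c + 1)`. -/
def ratNum (n : ℕ) : ℚ :=
  ((n.unpair.1.unpair.1 : ℚ) - (n.unpair.1.unpair.2 : ℚ)) / ((n.unpair.2 : ℚ) + 1)

/-- An effective numbering of the positive rational numbers: the number `⟨a, b⟩` names
`(a + 1) / (b + 1)`. -/
def posRatNum (n : ℕ) : ℚ :=
  ((n.unpair.1 : ℚ) + 1) / ((n.unpair.2 : ℚ) + 1)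

/-- The r.e. set `E_e`: the range of the partial recursive function with Gödel number `e`. -/
def reSet (e : ℕ) : Set ℕ :=
  {i | ∃ n, i ∈ (Nat.Partrec.Code.ofNatCode e).eval n}

/-- The real numbers `x 0, x 1, …` are computable, uniformly in the index: the sets of rationals
`{q | q < x n}` and `{q | x n < q}` are r.e., uniformly in `n`. -/
def UniformlyComputableReals (x : ℕ → ℝ) : Prop :=
  REPred (fun p : ℕ × ℕ => (ratNum p.2 : ℝ) < x p.1) ∧
    REPred (fun p : ℕ × ℕ => x p.1 < (ratNum p.2 : ℝ))

/-! ### Computable metric spaces -/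

/-- A numbered family of ideal points `s_0, s_1, …` (repetitions are allowed). -/
class IdealPoints (X : Type*) where
  idealPoint : ℕ → X

/-- A computable metric space: a separable complete metric space with a dense sequence of ideal
points whose mutual distances are uniformly computable. -/
class ComputableMetricSpace (X : Type*) [MetricSpace X] extends IdealPoints X where
  complete : CompleteSpace X
  dense : DenseRange idealPoint
  computable_dist : UniformlyComputableReals fun n =>
    dist (idealPoint n.unpair.1) (idealPoint n.unpair.2)

section Computability

variable {X Y : Type*} [Dist X] [IdealPoints X] [Dist Y] [IdealPoints Y]

/-- The ideal ball `B_⟨i,j⟩ = B(s_i, q_j)`, where `q_j` is the `j`-th positive rational. -/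
def idealBall (X : Type*) [Dist X] [IdealPoints X] (n : ℕ) : Set X :=
  {x | dist x (IdealPoints.idealPoint n.unpair.1) < (posRatNum n.unpair.2 : ℝ)}

/-- The `e`-th recursively open set `U_e`: the union of the ideal balls with index in `E_e`. -/
def recOpen (X : Type*) [Dist X] [IdealPoints X] (e : ℕ) : Set X :=
  ⋃ i ∈ reSet e, idealBall X i

/-- `U n` is recursively open uniformly in `n`: for some r.e. set `E ⊆ ℕ²`, each `U n` is the
union of the ideal balls `B_i` with `(n, i) ∈ E`. -/
def UniformlyRecOpen (U : ℕ → Set X) : Prop :=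
  ∃ E : Set (ℕ × ℕ), REPred (fun p : ℕ × ℕ => p ∈ E) ∧
    ∀ n, U n = ⋃ i ∈ {i | (n, i) ∈ E}, idealBall X i

/-- `T` is computable: `T ⁻¹(U_e)` is recursively open uniformly in `e`. -/
def ComputableMap (T : X → Y) : Prop :=
  UniformlyRecOpen fun e => T ⁻¹' recOpen Y e

/-- `T` is computable on `C`: there are `U n`, recursively open uniformly in `n`, with
`T ⁻¹(B_n) ∩ C = U n ∩ C`. -/
def ComputableMapOn (T : X → Y) (C : Set X) : Prop :=
  ∃ U : ℕ → Set X, UniformlyRecOpen U ∧ ∀ n, T ⁻¹' idealBall Y n ∩ C = U n ∩ C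

end Computability

/-! ### The space of Borel probability measures -/

/-- The Wasserstein–Kantorovich distance
`W₁(μ, ν) = sup {|∫ f dμ - ∫ f dν| : f 1-Lipschitz}`; used on bounded spaces, where the
integrals exist and the supremum is finite. -/
def W1 {X : Type*} [MetricSpace X] [MeasurableSpace X] (μ ν : ProbabilityMeasure X) : ℝ :=
  ⨆ f : {f : X → ℝ // LipschitzWith 1 f},
    |(∫ x, f.1 x ∂(μ : Measure X)) - ∫ x, f.1 x ∂(ν : Measure X)|

/-- Probability measures carry the distance `W₁`. -/
instance instDistProbabilityMeasure {X : Type*} [MetricSpace X] [MeasurableSpace X] :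
    Dist (ProbabilityMeasure X) :=
  ⟨W1⟩

/-- The `n`-th nonempty finite list of pairs `(i, k)`. -/
def weightList (n : ℕ) : List (ℕ × ℕ) :=
  (Denumerable.ofNat ((ℕ × ℕ) × List (ℕ × ℕ)) n).1 ::
    (Denumerable.ofNat ((ℕ × ℕ) × List (ℕ × ℕ)) n).2

/-- The positive integer `∑ (k + 1)`, the sum running over the pairs `(i, k)` of the `n`-th list. -/
def totalWeight (n : ℕ) : ℕ :=
  ((weightList n).map fun p => p.2 + 1).sum

/-- The `n`-th rational convex combination `∑ ((k + 1) / W) δ_{s_i}` of Dirac measures at ideal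
points: the sum runs over the pairs `(i, k)` of the `n`-th list, and `W` is its total weight. -/
def idealMeasure (X : Type*) [MeasurableSpace X] [IdealPoints X] (n : ℕ) : Measure X :=
  ((weightList n).map fun p =>
    (((p.2 + 1 : ℕ) : ENNReal) / (totalWeight n : ENNReal)) •
      Measure.dirac (IdealPoints.idealPoint p.1 : X)).sum

theorem listSum_apply_univ {X : Type*} [MeasurableSpace X] [IdealPoints X] (c : ENNReal)
    (l : List (ℕ × ℕ)) :
    (l.map fun p => (((p.2 + 1 : ℕ) : ENNReal) / c) •
      Measure.dirac (IdealPoints.idealPoint p.1 : X)).sum Set.univ =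
      (((l.map fun p => p.2 + 1).sum : ℕ) : ENNReal) / c := by
  induction l with
  | nil => simp
  | cons a l ih =>
    simp only [List.map_cons, List.sum_cons, Measure.add_apply, ih, Measure.smul_apply,
      measure_univ, smul_eq_mul, mul_one, Nat.cast_add (a.2 + 1), ENNReal.add_div]

theorem totalWeight_pos (n : ℕ) : 0 < totalWeight n := by
  simp [totalWeight, weightList]

instance isProbabilityMeasure_idealMeasure (X : Type*) [MeasurableSpace X] [IdealPoints X]
    (n : ℕ) : IsProbabilityMeasure (idealMeasure X n) := by
  constructor
  rw [idealMeasure, listSum_apply_univ]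
  exact ENNReal.div_self (by exact_mod_cast (totalWeight_pos n).ne') (ENNReal.natCast_ne_top _)

/-- The ideal points of the space of probability measures are the finite rational convex
combinations of Dirac measures at ideal points. -/
instance instIdealPointsProbabilityMeasure {X : Type*} [MeasurableSpace X] [IdealPoints X] :
    IdealPoints (ProbabilityMeasure X) :=
  ⟨fun n => ⟨idealMeasure X n, inferInstance⟩⟩

/-- `PM_D(X)`: the probability measures `μ` with `μ(D) = 0`. -/
def PMD {X : Type*} [MeasurableSpace X] (D : Set X) : Set (ProbabilityMeasure X) :=
  {μ | (μ : Measure X) D = 0}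

open Classical in
/-- The transfer operator `L_T`: the push-forward `μ ↦ T_* μ`, which is characterised by
`∫ f d(L_T μ) = ∫ f ∘ T dμ` and makes sense whenever `T` is `μ`-almost everywhere measurable
(in particular for all `μ` if `T` is Borel). Where it makes no sense the value is irrelevant. -/
def transferOperator {X : Type*} [MeasurableSpace X] (T : X → X) (μ : ProbabilityMeasure X) :
    ProbabilityMeasure X :=
  if h : AEMeasurable T (μ : Measure X) then μ.map h else μ

end CompAnalysis

end

open CompAnalysis

/-! That `L_T μ` lies within `q` of an ideal measure ν is shown to have a finite certificate that
can be found by search. A certificate is a transport plan: a uniform list of source atoms `s_a`,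
each paired with a target atom `s_c` of ν and a radius ρ such that, by an enumerable comparison of
balls, `T` sends the part of `B(s_a, 1/(R+1))` outside `D` into `B(s_c, ρ)`, or ρ is at least a
bound `M` on all distances.

Soundness: for 1-Lipschitz `f`, every entry gives `f (T x) ≤ f(s_c) + ρ + M(R+1) d(x, s_a)` off `D`.
The penalty term exceeds `M` as soon as `x` leaves the ball, so no global modulus of continuity of
`T` is needed. The minimum of these bounds is `M(R+1)`-Lipschitz, so its integral against μ is
controlled by `W1` from μ to the source. Integrating bounds `W1 (L_T μ) ν` by the mean radius plus
`M(R+1)/(P+1)`, where `1/(P+1)` is the radius of the source ball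
(`IsTransportPlan.transferOperator_mem`).

Completeness: if `W1 (L_T μ) ν < q`, approximate μ by a uniform list of as many atoms as ν has after
repetition, and let an assignment pay the least certified radii. If every assignment were too
expensive, linear programming duality (`exists_potentials_of_forall_perm`, from Birkhoff's theorem
and Hahn–Banach) would give potentials. These define Lipschitz functions that force `W1 (L_T μ) ν`
up to nearly `q` (`sum_potentials_div_le`). Continuity of `T` off `D` is uniform only outside a set
of small μ-measure, which costs at most `M` times that measure. -/

namespace CompAnalysis

/-! ### Closure properties of r.e. predicates -/

section RecursivelyEnumerable

variable {α β : Type*} [Primcodable α] [Primcodable β]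

/-- A recursively enumerable predicate is the union of an increasing sequence of primitive
recursive predicates. -/
theorem exists_primrec_stages {p : α → Prop} (hp : REPred p) :
    ∃ f : ℕ → α → Bool, Primrec₂ f ∧ (∀ k l a, k ≤ l → f k a = true → f l a = true) ∧
      ∀ a, p a ↔ ∃ k, f k a = true := by
  obtain ⟨c, hc⟩ := Nat.Partrec.Code.exists_code.1 hp
  refine ⟨fun k a => (Nat.Partrec.Code.evaln k c (Encodable.encode a)).isSome, ?_, ?_, ?_⟩
  · exact Primrec.option_isSome.comp (Nat.Partrec.Code.primrec_evaln.comp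
      ((Primrec.fst.pair (Primrec.const c)).pair (Primrec.encode.comp Primrec.snd)))
  · intro k l a hkl h
    rw [Option.isSome_iff_exists] at h ⊢
    obtain ⟨x, hx⟩ := h
    exact ⟨x, Nat.Partrec.Code.evaln_mono hkl hx⟩
  · intro a
    have h : p a ↔ (c.eval (Encodable.encode a)).Dom := by
      rw [hc]
      simp [Part.assert]
    rw [h, Part.dom_iff_mem]
    simp only [Option.isSome_iff_exists, Nat.Partrec.Code.evaln_complete, Option.mem_def]
    exact exists_comm

theorem rePred_of_exists {p : α → Prop} {f : ℕ → α → Bool} (hf : Primrec₂ f)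
    (h : ∀ a, p a ↔ ∃ k, f k a = true) : REPred p := by
  have hr : Partrec fun a => Nat.rfind fun k => Part.some (f k a) :=
    Partrec.rfind (p := fun a k => Part.some (f k a))
      (Computable.partrec (hf.to_comp.comp Computable.snd Computable.fst))
  refine hr.dom_re.of_eq fun a => Iff.trans ?_ (h a).symm
  refine Nat.rfind_dom'.trans ?_
  simp

theorem rePred_of_primrecPred {p : α → Prop} (hp : PrimrecPred p) : REPred p := by
  obtain ⟨_, h⟩ := hp
  exact ComputablePred.to_re ⟨_, h.to_comp⟩

theorem _root_.REPred.comp_primrec {p : β → Prop} (hp : REPred p) {g : α → β} (hg : Primrec g) :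
    REPred fun a => p (g a) :=
  Partrec.comp hp hg.to_comp

/-- Dovetailing: a single search number codes both the witness and the stage at which it is
accepted. -/
theorem _root_.REPred.exists_snd {p : α × β → Prop} (hp : REPred p) :
    REPred fun a => ∃ b, p (a, b) := by
  obtain ⟨f, hf, -, h⟩ := exists_primrec_stages hp
  refine rePred_of_exists
    (f := fun n a => ((Encodable.decode n.unpair.1 : Option β).map fun b =>
      f n.unpair.2 (a, b)).getD false) ?_ ?_
  · refine Primrec.option_getD.comp (Primrec.option_map
      (Primrec.decode.comp (Primrec.fst.comp (Primrec.unpair.comp Primrec.fst))) ?_)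
      (Primrec.const false)
    exact hf.comp (Primrec.snd.comp (Primrec.unpair.comp (Primrec.fst.comp Primrec.fst)))
      ((Primrec.snd.comp Primrec.fst).pair Primrec.snd)
  · intro a
    constructor
    · rintro ⟨b, hb⟩
      obtain ⟨k, hk⟩ := (h _).1 hb
      exact ⟨Nat.pair (Encodable.encode b) k, by simpa using hk⟩
    · rintro ⟨n, hn⟩
      cases hd : (Encodable.decode n.unpair.1 : Option β) with
      | none => simp [hd] at hn
      | some b => exact ⟨b, (h _).2 ⟨_, by simpa [hd] using hn⟩⟩

theorem _root_.REPred.and {p q : α → Prop} (hp : REPred p) (hq : REPred q) :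
    REPred fun a => p a ∧ q a := by
  obtain ⟨f, hf, hfm, h⟩ := exists_primrec_stages hp
  obtain ⟨g, hg, hgm, h'⟩ := exists_primrec_stages hq
  refine rePred_of_exists (f := fun k a => f k a && g k a) (Primrec.and.comp hf hg) fun a => ?_
  simp only [h, h', Bool.and_eq_true]
  constructor
  · rintro ⟨⟨k, hk⟩, l, hl⟩
    exact ⟨max k l, hfm _ _ _ (le_max_left _ _) hk, hgm _ _ _ (le_max_right _ _) hl⟩
  · rintro ⟨k, hk, hl⟩
    exact ⟨⟨k, hk⟩, k, hl⟩

theorem _root_.REPred.or {p q : α → Prop} (hp : REPred p) (hq : REPred q) :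
    REPred fun a => p a ∨ q a := by
  obtain ⟨f, hf, -, h⟩ := exists_primrec_stages hp
  obtain ⟨g, hg, -, h'⟩ := exists_primrec_stages hq
  refine rePred_of_exists (f := fun k a => f k a || g k a) (Primrec.or.comp hf hg) fun a => ?_
  simp only [h, h', Bool.or_eq_true, exists_or]

/-- Finitely many acceptances are all visible at the maximum of their stages, because stages
increase. -/
theorem _root_.REPred.forall_mem_list {p : α × β → Prop} (hp : REPred p) {L : α → List β}
    (hL : Primrec L) : REPred fun a => ∀ b ∈ L a, p (a, b) := by
  obtain ⟨f, hf, hfm, h⟩ := exists_primrec_stages hp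
  refine rePred_of_exists
    (f := fun k a => (L a).foldr (fun b r => f k (a, b) && r) true) ?_ fun a => ?_
  · refine Primrec.list_foldr (hL.comp Primrec.snd) (Primrec.const true)
      (h := fun q c => f q.1 (q.2, c.1) && c.2) ?_
    refine Primrec.and.comp (hf.comp (Primrec.fst.comp Primrec.fst)
      ((Primrec.snd.comp Primrec.fst).pair (Primrec.fst.comp Primrec.snd)))
      (Primrec.snd.comp Primrec.snd)
  · have key : ∀ k, ∀ l : List β, l.foldr (fun b r => f k (a, b) && r) true = true ↔
        ∀ b ∈ l, f k (a, b) = true := by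
      intro k l
      induction l with
      | nil => simp
      | cons b l ih => simp [ih]
    simp only [key, h]
    constructor
    · intro H
      generalize L a = l at H
      induction l with
      | nil => exact ⟨0, by simp⟩
      | cons b l ih =>
        obtain ⟨k, hk⟩ := ih fun b hb => H b (List.mem_cons_of_mem _ hb)
        obtain ⟨k', hk'⟩ := H b List.mem_cons_self
        refine ⟨max k k', fun c hc => ?_⟩
        rcases List.mem_cons.1 hc with rfl | hc
        · exact hfm _ _ _ (le_max_right _ _) hk'
        · exact hfm _ _ _ (le_max_left _ _) (hk c hc)
    · rintro ⟨k, hk⟩ b hb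
      exact ⟨k, hk b hb⟩

end RecursivelyEnumerable

theorem rePred_mem_reSet : REPred fun p : ℕ × ℕ => p.2 ∈ reSet p.1 := by
  have h : REPred fun p : (ℕ × ℕ) × (ℕ × ℕ) =>
      Nat.Partrec.Code.evaln p.2.1 (Nat.Partrec.Code.ofNatCode p.1.1) p.2.2 = some p.1.2 := by
    refine rePred_of_primrecPred (Primrec.eq.comp (Nat.Partrec.Code.primrec_evaln.comp
      (((Primrec.fst.comp Primrec.snd).pair
        ((Primrec.ofNat Nat.Partrec.Code).comp (Primrec.fst.comp Primrec.fst))).pair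
        (Primrec.snd.comp Primrec.snd))) (Primrec.option_some.comp
        (Primrec.snd.comp Primrec.fst)))
  refine h.exists_snd.of_eq fun p => ?_
  simp only [reSet, Set.mem_ofPred_eq, Nat.Partrec.Code.evaln_complete, Prod.exists, Option.mem_def]
  exact exists_comm

/-- An index of the r.e. set `{n}`, primitive recursive in `n`. -/
theorem exists_primrec_reSet_eq_singleton :
    ∃ g : ℕ → ℕ, Primrec g ∧ ∀ n, reSet (g n) = {n} := by
  refine ⟨fun n => Encodable.encode (Nat.Partrec.Code.const n),
    Primrec.encode.comp Nat.Partrec.Code.primrec_const, fun n => ?_⟩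
  have h : Nat.Partrec.Code.ofNatCode (Encodable.encode (Nat.Partrec.Code.const n)) =
      Nat.Partrec.Code.const n := Denumerable.ofNat_encode (Nat.Partrec.Code.const n)
  ext i
  simp [reSet, h, Nat.Partrec.Code.eval_const]

/-! ### The two notions of computable map -/

section Maps

variable {X Y : Type*} [Dist X] [IdealPoints X] [Dist Y] [IdealPoints Y]

/-- A single ideal ball is the recursively open set with index that of a singleton, and this index
depends computably on the ball. -/
theorem ComputableMap.computableMapOn_univ {T : X → Y} (hT : ComputableMap T) :
    ComputableMapOn T Set.univ := by
  obtain ⟨E, hE, h⟩ := hT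
  obtain ⟨g, hg, hgs⟩ := exists_primrec_reSet_eq_singleton
  refine ⟨fun n => T ⁻¹' recOpen Y (g n), ⟨{p | (g p.1, p.2) ∈ E},
    hE.comp_primrec ((hg.comp Primrec.fst).pair Primrec.snd), fun n => h (g n)⟩, fun n => ?_⟩
  simp [recOpen, hgs]

theorem ComputableMapOn.computableMap {T : X → Y} (hT : ComputableMapOn T Set.univ) :
    ComputableMap T := by
  obtain ⟨U, ⟨E, hE, hU⟩, h⟩ := hT
  refine ⟨{p | ∃ i, i ∈ reSet p.1 ∧ (i, p.2) ∈ E}, ?_, fun e => ?_⟩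
  · refine REPred.exists_snd (p := fun q : (ℕ × ℕ) × ℕ => q.2 ∈ reSet q.1.1 ∧ (q.2, q.1.2) ∈ E)
      (REPred.and (rePred_mem_reSet.comp_primrec
        ((Primrec.fst.comp Primrec.fst).pair Primrec.snd))
      (hE.comp_primrec (Primrec.snd.pair (Primrec.snd.comp Primrec.fst))))
  · have h' : ∀ n, T ⁻¹' idealBall Y n = U n := by simpa using h
    ext x
    simp only [recOpen, Set.preimage_iUnion, h', hU, Set.mem_iUnion, Set.mem_ofPred_eq]
    constructor
    · rintro ⟨i, hi, l, hl, hx⟩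
      exact ⟨l, ⟨i, hi, hl⟩, hx⟩
    · rintro ⟨l, ⟨i, hi, hl⟩, hx⟩
      exact ⟨i, hi, l, hl, hx⟩

end Maps

end CompAnalysis

/-! ### Ideal measures as lists, and the enumeration of certificates -/

namespace CompAnalysis

theorem primrec_weightList : Primrec weightList := by
  have h : Primrec fun n => Denumerable.ofNat ((ℕ × ℕ) × List (ℕ × ℕ)) n := by
    refine (Primrec.option_getD.comp
      (Primrec.decode (α := (ℕ × ℕ) × List (ℕ × ℕ))) (Primrec.const ((0, 0), []))).of_eq fun n => ?_
    have := Denumerable.decode_eq_ofNat ((ℕ × ℕ) × List (ℕ × ℕ)) n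
    exact congrArg (Option.getD · ((0, 0), [])) this
  exact Primrec.list_cons.comp (Primrec.fst.comp h) (Primrec.snd.comp h)

theorem exists_weightList_eq {l : List (ℕ × ℕ)} (hl : l ≠ []) : ∃ n, weightList n = l := by
  cases l with
  | nil => exact absurd rfl hl
  | cons a l => exact ⟨Encodable.encode (a, l), by
    rw [weightList, Denumerable.ofNat_encode]⟩

theorem primrec_list_sum : Primrec (List.sum : List ℕ → ℕ) :=
  (Primrec.list_foldr Primrec.id (Primrec.const 0)
    (h := fun _ p => p.1 + p.2)
    (Primrec.nat_add.comp (Primrec.fst.comp Primrec.snd) (Primrec.snd.comp Primrec.snd))).of_eq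
    fun _ => List.sum_eq_foldr.symm

/-- The atoms of the `n`-th ideal measure, an atom of weight `(k + 1) / W` repeated `N * (k + 1)`
times. -/
def repeatedAtoms (n N : ℕ) : List ℕ :=
  (weightList n).flatMap fun p => (List.range (N * (p.2 + 1))).map fun _ => p.1

theorem primrec_repeatedAtoms : Primrec₂ repeatedAtoms := by
  refine Primrec.list_flatMap (primrec_weightList.comp Primrec.fst)
    (g := fun q p => (List.range (q.2 * (p.2 + 1))).map fun _ => p.1) ?_
  refine Primrec.list_map (Primrec.list_range.comp (Primrec.nat_mul.comp
    (Primrec.snd.comp Primrec.fst) (Primrec.succ.comp (Primrec.snd.comp Primrec.snd)))) ?_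
  exact Primrec.fst.comp (Primrec.snd.comp Primrec.fst)

theorem sum_map_repeatedAtoms (n N : ℕ) (f : ℕ → ℝ) :
    ((repeatedAtoms n N).map f).sum =
      N * ((weightList n).map fun p => ((p.2 : ℝ) + 1) * f p.1).sum := by
  unfold repeatedAtoms
  induction weightList n with
  | nil => simp
  | cons p l ih =>
    rw [List.flatMap_cons, List.map_append, List.sum_append, ih, List.map_cons, List.sum_cons]
    simp [List.map_const']
    ring

theorem length_repeatedAtoms (n N : ℕ) : (repeatedAtoms n N).length = N * totalWeight n := by
  unfold repeatedAtoms totalWeight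
  induction weightList n with
  | nil => simp
  | cons p l ih => simp_all [mul_add]

/-- The index of the rational number obtained by subtracting `1 / (R + 1)` from the radius of the
`l`-th ideal ball. -/
def shrunkRadius (l R : ℕ) : ℕ :=
  Nat.pair (Nat.pair ((l.unpair.2.unpair.1 + 1) * (R + 1)) (l.unpair.2.unpair.2 + 1))
    ((l.unpair.2.unpair.2 + 1) * (R + 1) - 1)

theorem ratNum_shrunkRadius (l R : ℕ) :
    ratNum (shrunkRadius l R) = posRatNum l.unpair.2 - 1 / (R + 1) := by
  have h : (((l.unpair.2.unpair.2 + 1) * (R + 1) - 1 : ℕ) : ℚ) + 1 =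
      (l.unpair.2.unpair.2 + 1) * (R + 1) := by
    have h1 : (l.unpair.2.unpair.2 + 1) * (R + 1) - 1 + 1 = (l.unpair.2.unpair.2 + 1) * (R + 1) :=
      Nat.sub_add_cancel (Nat.mul_pos (Nat.succ_pos _) (Nat.succ_pos _))
    exact_mod_cast h1
  simp only [ratNum, shrunkRadius, posRatNum, Nat.unpair_pair, h]
  have h2 : ((l.unpair.2.unpair.2 : ℚ) + 1) ≠ 0 := by positivity
  have h3 : ((R : ℚ) + 1) ≠ 0 := by positivity
  push_cast
  field_simp

theorem primrec_shrunkRadius : Primrec₂ shrunkRadius := by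
  have hv : Primrec fun l : ℕ => l.unpair.2.unpair :=
    Primrec.unpair.comp (Primrec.snd.comp Primrec.unpair)
  have hu : Primrec fun q : ℕ × ℕ => q.1.unpair.2.unpair.1 + 1 :=
    Primrec.succ.comp (Primrec.fst.comp (hv.comp Primrec.fst))
  have hw : Primrec fun q : ℕ × ℕ => q.1.unpair.2.unpair.2 + 1 :=
    Primrec.succ.comp (Primrec.snd.comp (hv.comp Primrec.fst))
  have hR : Primrec fun q : ℕ × ℕ => q.2 + 1 := Primrec.succ.comp Primrec.snd
  exact Primrec₂.natPair.comp (Primrec₂.natPair.comp (Primrec.nat_mul.comp hu hR) hw)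
    (Primrec.nat_sub.comp (Primrec.nat_mul.comp hw hR) (Primrec.const 1))

section Certificates

variable {X : Type*} [MetricSpace X] [ComputableMetricSpace X]

/-- The ball of radius `1 / (R + 1)` at the ideal point `s_a` is, by comparison of centres and
radii, contained in a ball `B_l` with `(n, l) ∈ E`. -/
def BallInside (X : Type*) [MetricSpace X] [ComputableMetricSpace X] (E : Set (ℕ × ℕ))
    (R a n : ℕ) : Prop :=
  ∃ l, (n, l) ∈ E ∧ dist (IdealPoints.idealPoint a : X) (IdealPoints.idealPoint l.unpair.1) +
    1 / (R + 1) < (posRatNum l.unpair.2 : ℝ)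

theorem rePred_ballInside {E : Set (ℕ × ℕ)} (hE : REPred fun p : ℕ × ℕ => p ∈ E) :
    REPred fun q : ℕ × ℕ × ℕ => BallInside X E q.1 q.2.1 q.2.2 := by
  refine REPred.exists_snd (p := fun q : (ℕ × ℕ × ℕ) × ℕ => (q.1.2.2, q.2) ∈ E ∧
    dist (IdealPoints.idealPoint q.1.2.1 : X) (IdealPoints.idealPoint q.2.unpair.1) +
    1 / (q.1.1 + 1) < (posRatNum q.2.unpair.2 : ℝ)) (REPred.and (hE.comp_primrec
      ((Primrec.snd.comp (Primrec.snd.comp Primrec.fst)).pair Primrec.snd)) ?_)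
  -- Moving `1 / (R + 1)` to the right leaves a distance below a rational, which is semidecidable.
  -- That rational may be negative, hence the signed numbering `ratNum`.
  refine ((ComputableMetricSpace.computable_dist (X := X)).2.comp_primrec
    (g := fun q : (ℕ × ℕ × ℕ) × ℕ => (Nat.pair q.1.2.1 q.2.unpair.1, shrunkRadius q.2 q.1.1))
    ?_).of_eq fun q => ?_
  · exact (Primrec₂.natPair.comp (Primrec.fst.comp (Primrec.snd.comp Primrec.fst))
      (Primrec.fst.comp (Primrec.unpair.comp Primrec.snd))).pair
      (primrec_shrunkRadius.comp Primrec.snd (Primrec.fst.comp Primrec.fst))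
  · simp only [Nat.unpair_pair, ratNum_shrunkRadius]
    push_cast
    exact lt_sub_iff_add_lt

/-- The entry `(a, c, x)` of a transport plan: `T` maps the ball of radius `1 / (R + 1)` at `s_a`
into the ball of radius `(x + 1) / (K + 1)` at `s_c`, either because of `BallInside` or because
this radius exceeds the bound `M` on all distances. -/
def EntryValid (X : Type*) [MetricSpace X] [ComputableMetricSpace X] (E : Set (ℕ × ℕ))
    (M R K : ℕ) (t : ℕ × ℕ × ℕ) : Prop :=
  BallInside X E R t.1 (Nat.pair t.2.1 (Nat.pair t.2.2 K)) ∨ M * (K + 1) ≤ t.2.2 + 1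

/-- The list `L` of entries `(a, c, x)` of equal weight, with parameters `s = (N, R, K, P)`, is a
transport plan from the `j`-th ideal measure to the `i`-th one, which shows that the transfer
operator maps the ball of radius `1 / (P + 1)` at the former into the ball of radius `q_r` at the
latter, where `p = (⟨i, r⟩, ⟨j, ⟨0, P⟩⟩)`. -/
def IsTransportPlan (X : Type*) [MetricSpace X] [ComputableMetricSpace X] (E : Set (ℕ × ℕ))
    (M : ℕ) (p : ℕ × ℕ) (s : ℕ × ℕ × ℕ × ℕ) (L : List (ℕ × ℕ × ℕ)) : Prop :=
  weightList p.2.unpair.1 = L.map (fun t => (t.1, 0)) ∧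
  p.2.unpair.2 = Nat.pair 0 s.2.2.2 ∧
  L.map (fun t => t.2.1) = repeatedAtoms p.1.unpair.1 s.1 ∧
  (L.map fun t => t.2.2 + 1).sum * (s.2.2.2 + 1) * (p.1.unpair.2.unpair.2 + 1) +
      M * (s.2.1 + 1) * (s.2.2.1 + 1) * L.length * (p.1.unpair.2.unpair.2 + 1) <
    (p.1.unpair.2.unpair.1 + 1) * (s.2.2.1 + 1) * L.length * (s.2.2.2 + 1) ∧
  ∀ t ∈ L, EntryValid X E M s.2.1 s.2.2.1 t

/-- With denominators cleared, all conditions on a plan except the ball inclusions are primitive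
recursive. The inclusions are r.e. and only finitely many. -/
theorem rePred_exists_isTransportPlan {E : Set (ℕ × ℕ)} (hE : REPred fun p : ℕ × ℕ => p ∈ E)
    (M : ℕ) : REPred fun p : ℕ × ℕ => ∃ s L, IsTransportPlan X E M p s L := by
  suffices H : REPred fun q : (ℕ × ℕ) × ((ℕ × ℕ × ℕ × ℕ) × List (ℕ × ℕ × ℕ)) =>
      IsTransportPlan X E M q.1 q.2.1 q.2.2 from
    H.exists_snd.of_eq fun p => by simp only [Prod.exists]
  have hL : Primrec fun q : (ℕ × ℕ) × ((ℕ × ℕ × ℕ × ℕ) × List (ℕ × ℕ × ℕ)) => q.2.2 :=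
    Primrec.snd.comp Primrec.snd
  have hs : Primrec fun q : (ℕ × ℕ) × ((ℕ × ℕ × ℕ × ℕ) × List (ℕ × ℕ × ℕ)) => q.2.1 :=
    Primrec.fst.comp Primrec.snd
  have hR := Primrec.fst.comp (Primrec.snd.comp hs)
  have hK := Primrec.fst.comp (Primrec.snd.comp (Primrec.snd.comp hs))
  have hP := Primrec.snd.comp (Primrec.snd.comp (Primrec.snd.comp hs))
  have hn : Primrec fun q : (ℕ × ℕ) × ((ℕ × ℕ × ℕ × ℕ) × List (ℕ × ℕ × ℕ)) => q.1.1.unpair :=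
    Primrec.unpair.comp (Primrec.fst.comp Primrec.fst)
  have hi : Primrec fun q : (ℕ × ℕ) × ((ℕ × ℕ × ℕ × ℕ) × List (ℕ × ℕ × ℕ)) => q.1.2.unpair :=
    Primrec.unpair.comp (Primrec.snd.comp Primrec.fst)
  have hr := Primrec.unpair.comp (Primrec.snd.comp hn)
  have hu := Primrec.succ.comp (Primrec.fst.comp hr)
  have hv := Primrec.succ.comp (Primrec.snd.comp hr)
  have hlen := Primrec.list_length.comp hL
  have hP1 := Primrec.succ.comp hP
  have hK1 := Primrec.succ.comp hK
  have hR1 := Primrec.succ.comp hR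
  have hsum : Primrec fun q : (ℕ × ℕ) × ((ℕ × ℕ × ℕ × ℕ) × List (ℕ × ℕ × ℕ)) =>
      (q.2.2.map fun t => t.2.2 + 1).sum :=
    primrec_list_sum.comp (Primrec.list_map hL
      (Primrec.succ.comp (Primrec.snd.comp (Primrec.snd.comp Primrec.snd))))
  refine REPred.and (rePred_of_primrecPred (Primrec.eq.comp
      (primrec_weightList.comp (Primrec.fst.comp hi)) (Primrec.list_map hL
        ((Primrec.fst.comp Primrec.snd).pair (Primrec.const 0))))) <|
    REPred.and (rePred_of_primrecPred (Primrec.eq.comp (Primrec.snd.comp hi)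
      (Primrec₂.natPair.comp (Primrec.const 0) hP))) <|
    REPred.and (rePred_of_primrecPred (Primrec.eq.comp (Primrec.list_map hL
        (Primrec.fst.comp (Primrec.snd.comp Primrec.snd)))
        (primrec_repeatedAtoms.comp (Primrec.fst.comp hn) (Primrec.fst.comp hs)))) <|
    REPred.and (rePred_of_primrecPred ?_) ?_
  · have mul := fun {α : Type} [Primcodable α] {f g : α → ℕ} (hf : Primrec f) (hg : Primrec g) =>
      Primrec.nat_mul.comp hf hg
    exact Primrec.nat_lt.comp (Primrec.nat_add.comp (mul (mul hsum hP1) hv)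
      (mul (mul (mul (mul (Primrec.const M) hR1) hK1) hlen) hv))
      (mul (mul (mul hu hK1) hlen) hP1)
  · refine REPred.forall_mem_list (p := fun q : ((ℕ × ℕ) × ((ℕ × ℕ × ℕ × ℕ) ×
      List (ℕ × ℕ × ℕ))) × (ℕ × ℕ × ℕ) => EntryValid X E M q.1.2.1.2.1 q.1.2.1.2.2.1 q.2)
      (REPred.or ?_ (rePred_of_primrecPred ?_)) hL
    · exact (rePred_ballInside (X := X) hE).comp_primrec
        (g := fun q : ((ℕ × ℕ) × ((ℕ × ℕ × ℕ × ℕ) × List (ℕ × ℕ × ℕ))) × (ℕ × ℕ × ℕ) =>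
          (q.1.2.1.2.1, q.2.1, Nat.pair q.2.2.1 (Nat.pair q.2.2.2 q.1.2.1.2.2.1)))
        ((hR.comp Primrec.fst).pair ((Primrec.fst.comp Primrec.snd).pair (Primrec₂.natPair.comp
          (Primrec.fst.comp (Primrec.snd.comp Primrec.snd)) (Primrec₂.natPair.comp
          (Primrec.snd.comp (Primrec.snd.comp Primrec.snd)) (hK.comp Primrec.fst)))))
    · exact Primrec.nat_le.comp (Primrec.nat_mul.comp (Primrec.const M) (hK1.comp Primrec.fst))
        (Primrec.succ.comp (Primrec.snd.comp (Primrec.snd.comp Primrec.snd)))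

/-- The numerical condition on a transport plan, for real numbers. -/
theorem cost_lt_iff {S M R K P len r : ℕ} (hlen : 0 < len) :
    S * (P + 1) * (r.unpair.2 + 1) + M * (R + 1) * (K + 1) * len * (r.unpair.2 + 1) <
        (r.unpair.1 + 1) * (K + 1) * len * (P + 1) ↔
      (S : ℝ) / (K + 1) / len + M * (R + 1) / (P + 1) < (posRatNum r : ℝ) := by
  have hl : (0 : ℝ) < len := by exact_mod_cast hlen
  have hK : (0 : ℝ) < K + 1 := by positivity
  have hP : (0 : ℝ) < P + 1 := by positivity
  have hv : (0 : ℝ) < r.unpair.2 + 1 := by positivity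
  have h : (S : ℝ) / (K + 1) / len + M * (R + 1) / (P + 1) =
      (S * (P + 1) + M * (R + 1) * (K + 1) * len) / ((K + 1) * len * (P + 1)) := by
    field_simp
  rw [h, posRatNum]
  push_cast
  rw [div_lt_div_iff₀ (by positivity) hv, ← Nat.cast_lt (α := ℝ)]
  push_cast
  constructor <;> intro h <;> linarith

end Certificates

end CompAnalysis

/-! ### Measurability from preimages of ideal balls -/

namespace CompAnalysis

section Topology

variable {X : Type*} [MetricSpace X] [ComputableMetricSpace X]

theorem isOpen_idealBall (n : ℕ) : IsOpen (idealBall X n) :=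
  Metric.isOpen_ball

theorem exists_posRatNum_lt {ε : ℝ} (hε : 0 < ε) : ∃ k, (posRatNum k : ℝ) < ε := by
  obtain ⟨k, hk⟩ := exists_nat_one_div_lt hε
  exact ⟨Nat.pair 0 k, by simpa [posRatNum] using hk⟩

theorem exists_mem_idealBall_subset {O : Set X} (hO : IsOpen O) {x : X} (hx : x ∈ O) :
    ∃ n, x ∈ idealBall X n ∧ idealBall X n ⊆ O := by
  obtain ⟨ε, hε, h⟩ := Metric.isOpen_iff.1 hO x hx
  obtain ⟨k, hk⟩ := exists_posRatNum_lt (half_pos hε)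
  have hpos : (0 : ℝ) < posRatNum k := by
    simp only [posRatNum]; push_cast; positivity
  obtain ⟨i, hi⟩ := (ComputableMetricSpace.dense (X := X)).exists_dist_lt x hpos
  refine ⟨Nat.pair i k, by simpa [idealBall] using hi, fun y hy => h ?_⟩
  simp only [idealBall, Nat.unpair_pair, Set.mem_ofPred_eq] at hy
  rw [Metric.mem_ball]
  have := dist_triangle_right y x (IdealPoints.idealPoint i : X)
  linarith

theorem eq_iUnion_idealBall {O : Set X} (hO : IsOpen O) :
    O = ⋃ n ∈ {n | idealBall X n ⊆ O}, idealBall X n := by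
  ext x
  simp only [Set.mem_iUnion, Set.mem_ofPred_eq, exists_prop]
  constructor
  · intro hx
    obtain ⟨n, h1, h2⟩ := exists_mem_idealBall_subset hO hx
    exact ⟨n, h2, h1⟩
  · rintro ⟨n, h2, h1⟩
    exact h2 h1

theorem UniformlyRecOpen.isOpen {U : ℕ → Set X} (hU : UniformlyRecOpen U) (n : ℕ) :
    IsOpen (U n) := by
  obtain ⟨E, -, h⟩ := hU
  rw [h]
  exact isOpen_biUnion fun _ _ => isOpen_idealBall _

variable [MeasurableSpace X] [BorelSpace X]

theorem aemeasurable_of_preimage_idealBall {Y : Type*} [MeasurableSpace Y] {T : Y → X}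
    {μ : Measure Y} (h : ∀ n, NullMeasurableSet (T ⁻¹' idealBall X n) μ) : AEMeasurable T μ := by
  have : TopologicalSpace.SeparableSpace X :=
    ⟨_, Set.countable_range _, ComputableMetricSpace.dense (X := X)⟩
  have : SecondCountableTopology X := UniformSpace.secondCountable_of_separable X
  -- Null measurability is ordinary measurability for the completed σ-algebra. Second countability
  -- of `X` later turns it into almost everywhere measurability.
  have hT : Measurable[NullMeasurableSpace.instMeasurableSpace (μ := μ)] T := by
    refine @measurable_of_isOpen _ _ _ _ _
      (NullMeasurableSpace.instMeasurableSpace (μ := μ)) _ fun O hO => ?_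
    change NullMeasurableSet (T ⁻¹' O) μ
    rw [eq_iUnion_idealBall hO]
    simp only [Set.preimage_iUnion]
    exact NullMeasurableSet.biUnion (Set.to_countable _) fun n _ => h n
  exact NullMeasurable.aemeasurable (fun s hs => hT hs)

/-- Preimages of ideal balls agree with open sets off the null set `D`, which itself need not be
measurable. -/
theorem ComputableMapOn.aemeasurable {T : X → X} {D : Set X} (hT : ComputableMapOn T Dᶜ)
    {μ : Measure X} (hμ : μ D = 0) : AEMeasurable T μ := by
  obtain ⟨U, hU, h⟩ := hT
  refine aemeasurable_of_preimage_idealBall fun n => ?_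
  refine (hU.isOpen n).measurableSet.nullMeasurableSet.congr ?_
  have hD : ∀ᵐ x ∂μ, x ∈ Dᶜ := measure_eq_zero_iff_ae_notMem.1 hμ
  filter_upwards [hD] with x hx
  have := Set.ext_iff.1 (h n) x
  simp only [Set.mem_inter_iff, hx, and_true] at this
  exact propext this.symm

theorem ComputableMap.measurable {T : X → X} (hT : ComputableMap T) : Measurable T := by
  obtain ⟨U, hU, h⟩ := hT.computableMapOn_univ
  have h' : ∀ n, T ⁻¹' idealBall X n = U n := by simpa using h
  refine measurable_of_isOpen fun O hO => ?_
  rw [eq_iUnion_idealBall hO]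
  simp only [Set.preimage_iUnion, h']
  exact MeasurableSet.biUnion (Set.to_countable _) fun n _ => (hU.isOpen n).measurableSet

end Topology

/-! ### Integrals of Lipschitz functions and `W1` -/

section Wasserstein

theorem abs_sub_le_diam {X : Type*} [MetricSpace X] [BoundedSpace X] {f : X → ℝ} (hf : LipschitzWith 1 f) (x y : X) :
    |f x - f y| ≤ Metric.diam (Set.univ : Set X) := by
  have h := hf.dist_le_mul x y
  rw [Real.dist_eq, NNReal.coe_one, one_mul] at h
  exact h.trans (Metric.dist_le_diam_of_mem (Bornology.isBounded_univ.2 inferInstance)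
    trivial trivial)

/-- One-sided bounds suffice, since the 1-Lipschitz functions are closed under negation. -/
theorem W1_le {X : Type*} [MetricSpace X] [MeasurableSpace X] {μ ν : ProbabilityMeasure X} {c : ℝ}
    (h : ∀ f : X → ℝ, LipschitzWith 1 f →
      (∫ x, f x ∂(μ : Measure X)) - ∫ x, f x ∂(ν : Measure X) ≤ c) : W1 μ ν ≤ c := by
  have : Nonempty {f : X → ℝ // LipschitzWith 1 f} := ⟨⟨fun _ => 0, LipschitzWith.const' 0⟩⟩
  refine ciSup_le fun ⟨f, hf⟩ => abs_le'.2 ⟨h f hf, ?_⟩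
  have := h (fun x => -f x) hf.neg
  simp only [integral_neg] at this
  linarith

theorem integral_transferOperator {X : Type*} [MetricSpace X] [MeasurableSpace X]
    [BorelSpace X] {T : X → X} {μ : ProbabilityMeasure X}
    (hT : AEMeasurable T (μ : Measure X)) {f : X → ℝ} (hf : Continuous f) :
    ∫ x, f x ∂(transferOperator T μ : Measure X) = ∫ x, f (T x) ∂(μ : Measure X) := by
  rw [transferOperator, dif_pos hT]
  exact integral_map hT hf.measurable.aestronglyMeasurable

variable {X : Type*} [MetricSpace X] [BoundedSpace X] [MeasurableSpace X] [BorelSpace X]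

theorem _root_.LipschitzWith.integrable_of_boundedSpace {K : NNReal} {f : X → ℝ}
    (hf : LipschitzWith K f) (μ : Measure X) [IsProbabilityMeasure μ] : Integrable f μ := by
  obtain ⟨x₀⟩ := μ.nonempty_of_neZero
  refine Integrable.of_bound hf.continuous.measurable.aestronglyMeasurable
    (K * Metric.diam (Set.univ : Set X) + |f x₀|) (Filter.Eventually.of_forall fun x => ?_)
  have h1 := hf.dist_le_mul x x₀
  have h2 : dist x x₀ ≤ Metric.diam (Set.univ : Set X) :=
    Metric.dist_le_diam_of_mem (Bornology.isBounded_univ.2 inferInstance) trivial trivial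
  rw [Real.dist_eq] at h1
  have h3 : |f x| ≤ |f x - f x₀| + |f x₀| := by
    simpa using abs_add_le (f x - f x₀) (f x₀)
  have h4 := mul_le_mul_of_nonneg_left h2 K.coe_nonneg
  rw [Real.norm_eq_abs]
  linarith

theorem abs_integral_sub_le_W1 (μ ν : ProbabilityMeasure X) {f : X → ℝ}
    (hf : LipschitzWith 1 f) :
    |(∫ x, f x ∂(μ : Measure X)) - ∫ x, f x ∂(ν : Measure X)| ≤ W1 μ ν := by
  refine le_ciSup (f := fun f : {f : X → ℝ // LipschitzWith 1 f} =>
    |(∫ x, f.1 x ∂(μ : Measure X)) - ∫ x, f.1 x ∂(ν : Measure X)|) ?_ ⟨f, hf⟩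
  -- The supremum must be shown bounded, as a real supremum of an unbounded family is 0 by
  -- convention. Both integrals are within the diameter of `g x₀`.
  obtain ⟨x₀⟩ := (μ : Measure X).nonempty_of_neZero
  refine ⟨Metric.diam (Set.univ : Set X) + Metric.diam (Set.univ : Set X), ?_⟩
  rintro _ ⟨⟨g, hg⟩, rfl⟩
  have key : ∀ ξ : ProbabilityMeasure X,
      |(∫ x, g x ∂(ξ : Measure X)) - g x₀| ≤ Metric.diam (Set.univ : Set X) := by
    intro ξ
    have h : (∫ x, g x ∂(ξ : Measure X)) - g x₀ = ∫ x, (g x - g x₀) ∂(ξ : Measure X) := by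
      rw [integral_sub (hg.integrable_of_boundedSpace _) (integrable_const _)]
      simp
    rw [h, ← Real.norm_eq_abs]
    refine (norm_integral_le_of_norm_le_const (C := Metric.diam (Set.univ : Set X))
      (Filter.Eventually.of_forall fun x => ?_)).trans (by simp)
    exact abs_sub_le_diam hg x x₀
  have h1 := abs_le.1 (key μ)
  have h2 := abs_le.1 (key ν)
  exact abs_le.2 ⟨by linarith, by linarith⟩

theorem abs_integral_sub_le_mul_W1 (μ ν : ProbabilityMeasure X) {K : NNReal} {f : X → ℝ}
    (hf : LipschitzWith K f) :
    |(∫ x, f x ∂(μ : Measure X)) - ∫ x, f x ∂(ν : Measure X)| ≤ K * W1 μ ν := by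
  rcases eq_or_ne K 0 with rfl | hK
  · obtain ⟨x₀⟩ := (μ : Measure X).nonempty_of_neZero
    have h : f = fun _ => f x₀ := by
      funext x
      have := hf.dist_le_mul x x₀
      simpa using this
    rw [h]
    simp
  · have hg : LipschitzWith 1 fun x => (K : ℝ)⁻¹ * f x := by
      refine LipschitzWith.of_dist_le_mul fun x y => ?_
      have h := hf.dist_le_mul x y
      have hK' : (0 : ℝ) < K := by positivity
      rw [Real.dist_eq] at h ⊢
      rw [← mul_sub, abs_mul, abs_of_pos (inv_pos.2 hK'), inv_mul_le_iff₀ hK']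
      simpa using h
    have h := abs_integral_sub_le_W1 μ ν hg
    have hK' : (0 : ℝ) < K := by positivity
    rw [integral_const_mul, integral_const_mul, ← mul_sub, abs_mul, abs_of_pos (inv_pos.2 hK'),
      inv_mul_le_iff₀ hK'] at h
    exact h

theorem integrable_comp_of_aemeasurable {T : X → X} {μ : Measure X} [IsProbabilityMeasure μ]
    (hT : AEMeasurable T μ) {f : X → ℝ} (hf : LipschitzWith 1 f) :
    Integrable (fun x => f (T x)) μ := by
  have := Measure.isProbabilityMeasure_map hT
  exact (hf.integrable_of_boundedSpace (μ.map T)).comp_aemeasurable hT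

end Wasserstein

/-! ### Integration against ideal measures -/

section IdealMeasure

variable {X : Type*} [MetricSpace X] [IdealPoints X] [MeasurableSpace X] [BorelSpace X]

theorem integral_idealMeasure (n : ℕ) (f : X → ℝ) :
    ∫ x, f x ∂(idealMeasure X n) =
      ((weightList n).map fun p => ((p.2 : ℝ) + 1) * f (IdealPoints.idealPoint p.1)).sum /
        totalWeight n := by
  have hW := totalWeight_pos n
  unfold idealMeasure
  -- The denominator has to stay fixed while the list shrinks in the induction.
  generalize totalWeight n = W at hW
  have key : ∀ l : List (ℕ × ℕ), Integrable f (l.map fun p => (((p.2 + 1 : ℕ) : ENNReal) /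
      (W : ENNReal)) • Measure.dirac (IdealPoints.idealPoint p.1 : X)).sum ∧
      ∫ x, f x ∂(l.map fun p => (((p.2 + 1 : ℕ) : ENNReal) / (W : ENNReal)) •
        Measure.dirac (IdealPoints.idealPoint p.1 : X)).sum =
      (l.map fun p => ((p.2 : ℝ) + 1) * f (IdealPoints.idealPoint p.1)).sum / W := by
    intro l
    induction l with
    | nil => simp
    | cons p l ih =>
      have hp : Integrable f ((((p.2 + 1 : ℕ) : ENNReal) / (W : ENNReal)) •
          Measure.dirac (IdealPoints.idealPoint p.1 : X)) :=
        (integrable_dirac (by simp)).smul_measure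
          (ENNReal.div_ne_top (ENNReal.natCast_ne_top _) (by exact_mod_cast hW.ne'))
      simp only [List.map_cons, List.sum_cons]
      refine ⟨hp.add_measure ih.1, ?_⟩
      rw [integral_add_measure hp ih.1, ih.2, integral_smul_measure, integral_dirac,
        ENNReal.toReal_div, ENNReal.toReal_natCast, ENNReal.toReal_natCast]
      push_cast
      simp only [smul_eq_mul]
      ring
  exact (key _).2

theorem integral_idealMeasure_of_uniform {n : ℕ} {l : List ℕ}
    (h : weightList n = l.map fun a => (a, 0)) (f : X → ℝ) :
    ∫ x, f x ∂(idealMeasure X n) =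
      (l.map fun a => f (IdealPoints.idealPoint a)).sum / l.length := by
  have hW : totalWeight n = l.length := by
    rw [totalWeight, h]
    simp [Function.comp_def]
  rw [integral_idealMeasure, h, hW]
  simp [Function.comp_def]

end IdealMeasure

/-- The greatest lower bound of finitely many `K`-Lipschitz functions is `K`-Lipschitz. -/
theorem exists_lipschitzWith_forall_le {X ι : Type*} [PseudoMetricSpace X] {K : NNReal}
    {h : ι → X → ℝ} (hh : ∀ i, LipschitzWith K (h i)) {l : List ι} (hl : l ≠ []) :
    ∃ g : X → ℝ, LipschitzWith K g ∧ (∀ i ∈ l, ∀ x, g x ≤ h i x) ∧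
      ∀ x, ∃ i ∈ l, g x = h i x := by
  induction l with
  | nil => exact absurd rfl hl
  | cons i l ih =>
    rcases eq_or_ne l [] with rfl | hl'
    · exact ⟨h i, hh i, by simp, by simp⟩
    · obtain ⟨g, hg, h1, h2⟩ := ih hl'
      refine ⟨fun x => min (h i x) (g x), by simpa using (hh i).min hg, ?_, fun x => ?_⟩
      · intro j hj x
        rcases List.mem_cons.1 hj with rfl | hj
        · exact min_le_left _ _
        · exact (min_le_right _ _).trans (h1 j hj x)
      · rcases min_choice (h i x) (g x) with h' | h'
        · exact ⟨i, List.mem_cons_self, h'⟩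
        · obtain ⟨j, hj, hj'⟩ := h2 x
          exact ⟨j, List.mem_cons_of_mem _ hj, h'.trans hj'⟩

end CompAnalysis

namespace CompAnalysis

theorem integral_idealMeasure_of_repeatedAtoms {X : Type*} [MetricSpace X] [IdealPoints X]
    [MeasurableSpace X] [BorelSpace X] {i N : ℕ} (hN : N ≠ 0) (f : X → ℝ) :
    ∫ x, f x ∂(idealMeasure X i) =
      ((repeatedAtoms i N).map fun a => f (IdealPoints.idealPoint a)).sum /
        (repeatedAtoms i N).length := by
  rw [integral_idealMeasure, sum_map_repeatedAtoms, length_repeatedAtoms]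
  have h1 : (totalWeight i : ℝ) ≠ 0 := by exact_mod_cast (totalWeight_pos i).ne'
  have h2 : (N : ℝ) ≠ 0 := by exact_mod_cast hN
  push_cast
  field_simp

/-! ### Soundness of transport plans -/

section Soundness

variable {X : Type*} [MetricSpace X] [ComputableMetricSpace X]

/-- Inside the ball at the source atom, the certified inclusion bounds the distance from `T x` to
the target atom. Outside it the penalty is at least `M`, and for an entry with radius at least `M`
there is nothing to certify. -/
theorem EntryValid.apply_le {T : X → X} {C : Set X} {E : Set (ℕ × ℕ)}
    (hE : ∀ n, T ⁻¹' idealBall X n ∩ C = (⋃ l ∈ {l | (n, l) ∈ E}, idealBall X l) ∩ C)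
    {M : ℕ} (hM : ∀ x y : X, dist x y ≤ M) {R K : ℕ} {t : ℕ × ℕ × ℕ}
    (ht : EntryValid X E M R K t) {f : X → ℝ} (hf : LipschitzWith 1 f) {x : X} (hx : x ∈ C) :
    f (T x) ≤ f (IdealPoints.idealPoint t.2.1) + (t.2.2 + 1) / (K + 1) +
      M * (R + 1) * dist x (IdealPoints.idealPoint t.1) := by
  have hR : (0 : ℝ) < R + 1 := by positivity
  have hK : (0 : ℝ) < K + 1 := by positivity
  have hd : (0 : ℝ) ≤ M * (R + 1) * dist x (IdealPoints.idealPoint t.1) := by positivity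
  have hfd : f (T x) ≤ f (IdealPoints.idealPoint t.2.1) +
      dist (T x) (IdealPoints.idealPoint t.2.1) := by
    have h := hf.dist_le_mul (T x) (IdealPoints.idealPoint t.2.1)
    rw [Real.dist_eq, NNReal.coe_one, one_mul] at h
    linarith [(abs_le.1 h).2]
  rcases ht with ⟨l, hl, hlt⟩ | ht
  · by_cases hxa : dist x (IdealPoints.idealPoint t.1) < 1 / (R + 1)
    · have hxl : x ∈ idealBall X l := by
        have := dist_triangle x (IdealPoints.idealPoint t.1 : X)
          (IdealPoints.idealPoint l.unpair.1)
        simp only [idealBall, Set.mem_ofPred_eq]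
        linarith
      have hmem : x ∈ (⋃ l ∈ {l | (Nat.pair t.2.1 (Nat.pair t.2.2 K), l) ∈ E},
          idealBall X l) ∩ C :=
        ⟨Set.mem_biUnion (show l ∈ {l | _} from hl) hxl, hx⟩
      rw [← hE] at hmem
      have h := hmem.1
      simp only [idealBall, posRatNum, Set.mem_preimage, Nat.unpair_pair, Set.mem_ofPred_eq] at h
      push_cast at h
      linarith
    · have h1 : (M : ℝ) ≤ M * (R + 1) * dist x (IdealPoints.idealPoint t.1) := by
        rw [not_lt, div_le_iff₀' hR] at hxa
        nlinarith [Nat.cast_nonneg (α := ℝ) M]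
      have h2 : (0 : ℝ) < (t.2.2 + 1) / (K + 1) := by positivity
      linarith [hM (T x) (IdealPoints.idealPoint t.2.1)]
  · have h1 : (M : ℝ) ≤ (t.2.2 + 1) / (K + 1) := by
      rw [le_div_iff₀ hK]
      exact_mod_cast ht
    linarith [hM (T x) (IdealPoints.idealPoint t.2.1)]

theorem IsTransportPlan.transferOperator_mem [BoundedSpace X] [MeasurableSpace X] [BorelSpace X]
    {T : X → X} {D : Set X} {E : Set (ℕ × ℕ)}
    (hE : ∀ n, T ⁻¹' idealBall X n ∩ Dᶜ = (⋃ l ∈ {l | (n, l) ∈ E}, idealBall X l) ∩ Dᶜ)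
    {M : ℕ} (hM : ∀ x y : X, dist x y ≤ M) {p : ℕ × ℕ} {s : ℕ × ℕ × ℕ × ℕ}
    {L : List (ℕ × ℕ × ℕ)} (hL : IsTransportPlan X E M p s L) {μ : ProbabilityMeasure X}
    (hT : AEMeasurable T (μ : Measure X)) (hμ : μ ∈ PMD D)
    (hp : μ ∈ idealBall (ProbabilityMeasure X) p.2) :
    transferOperator T μ ∈ idealBall (ProbabilityMeasure X) p.1 := by
  obtain ⟨N, R, K, P⟩ := s
  obtain ⟨h1, h2, h3, h4, h5⟩ := hL
  simp only at h1 h2 h3 h4 h5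
  have hL0 : L ≠ [] := by
    rintro rfl
    simp [weightList] at h1
  have hlen : 0 < L.length := List.length_pos_of_ne_nil hL0
  -- With `N = 0` the list of repeated atoms is empty, whereas `L` matches a nonempty weight list.
  have hN : N ≠ 0 := by
    rintro rfl
    have := congrArg List.length h3
    rw [length_repeatedAtoms, List.length_map] at this
    omega
  rw [cost_lt_iff hlen] at h4
  change W1 (transferOperator T μ) ⟨idealMeasure X p.1.unpair.1, _⟩ < _
  refine lt_of_le_of_lt (W1_le fun f hf => ?_) h4
  rw [integral_transferOperator hT hf.continuous]
  -- `g` majorises `f ∘ T` off `D`, and at each source atom it is at most the value of `f` at the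
  -- matched target atom plus the radius.
  obtain ⟨g, hg, hgle, hgeq⟩ := exists_lipschitzWith_forall_le (K := (M * (R + 1) : NNReal))
    (h := fun (t : ℕ × ℕ × ℕ) (x : X) => f (IdealPoints.idealPoint t.2.1) +
      ((t.2.2 : ℝ) + 1) / (K + 1) + M * (R + 1) * dist x (IdealPoints.idealPoint t.1))
    (fun t => by
      refine LipschitzWith.of_dist_le_mul fun x y => ?_
      rw [Real.dist_eq, add_sub_add_left_eq_sub, ← mul_sub, abs_mul,
        abs_of_nonneg (by positivity)]
      push_cast
      exact mul_le_mul_of_nonneg_left (abs_dist_sub_le _ _ _) (by positivity)) hL0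
  have hfg : ∫ x, f (T x) ∂(μ : Measure X) ≤ ∫ x, g x ∂(μ : Measure X) := by
    refine integral_mono_ae (integrable_comp_of_aemeasurable hT hf)
      (hg.integrable_of_boundedSpace _) ?_
    have hD : ∀ᵐ x ∂(μ : Measure X), x ∈ Dᶜ := measure_eq_zero_iff_ae_notMem.1 hμ
    filter_upwards [hD] with x hx
    obtain ⟨t, ht, hgx⟩ := hgeq x
    rw [hgx]
    exact (h5 t ht).apply_le hE hM hf hx
  have hgW : ∫ x, g x ∂(μ : Measure X) ≤ ∫ x, g x ∂(idealMeasure X p.2.unpair.1) +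
      M * (R + 1) / (P + 1) := by
    have hW := (abs_le.1 (abs_integral_sub_le_mul_W1 μ
      (IdealPoints.idealPoint p.2.unpair.1 : ProbabilityMeasure X) hg)).2
    have hlt : W1 μ (IdealPoints.idealPoint p.2.unpair.1 : ProbabilityMeasure X) <
        1 / (P + 1) := by
      have : W1 μ (IdealPoints.idealPoint p.2.unpair.1 : ProbabilityMeasure X) <
        (posRatNum p.2.unpair.2 : ℝ) := hp
      simpa [h2, posRatNum] using this
    have := mul_le_mul_of_nonneg_left hlt.le (by positivity : (0 : ℝ) ≤ M * (R + 1))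
    rw [mul_one_div] at this
    push_cast at hW
    change (∫ x, g x ∂(μ : Measure X)) - ∫ x, g x ∂(idealMeasure X p.2.unpair.1) ≤ _ at hW
    linarith
  have hgm : ∫ x, g x ∂(idealMeasure X p.2.unpair.1) ≤ ∫ x, f x ∂(idealMeasure X p.1.unpair.1) +
      ((L.map fun t => t.2.2 + 1).sum : ℕ) / (K + 1) / L.length := by
    rw [integral_idealMeasure_of_uniform (l := L.map fun t => t.1) (by rw [List.map_map]; exact h1),
      integral_idealMeasure_of_repeatedAtoms hN, ← h3, List.length_map, List.length_map,
      ← add_div]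
    refine div_le_div_of_nonneg_right ?_ (Nat.cast_nonneg _)
    rw [List.map_map, List.map_map]
    have key : ∀ l : List (ℕ × ℕ × ℕ), (∀ t ∈ l, t ∈ L) →
        (l.map ((fun a => g (IdealPoints.idealPoint a)) ∘ fun t => t.1)).sum ≤
        (l.map ((fun a => f (IdealPoints.idealPoint a)) ∘ fun t => t.2.1)).sum +
          ((l.map fun t => t.2.2 + 1).sum : ℕ) / (K + 1) := by
      intro l hl
      induction l with
      | nil => simp
      | cons t l ih =>
        have h := ih fun t' ht' => hl t' (List.mem_cons_of_mem _ ht')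
        have h' := hgle t (hl t List.mem_cons_self) (IdealPoints.idealPoint t.1)
        rw [dist_self, mul_zero, add_zero] at h'
        simp only [List.map_cons, List.sum_cons, Function.comp_apply]
        push_cast
        rw [add_div]
        push_cast at h
        linarith
    exact key L fun _ h => h
  change _ - ∫ x, f x ∂(idealMeasure X p.1.unpair.1) ≤ _
  linarith

end Soundness

end CompAnalysis

/-! ### Assignment duality and rounding of probability vectors -/

namespace CompAnalysis

/-- **Duality for the assignment problem.** If every assignment costs at least `c`, then there are
potentials of total value arbitrarily close to `c`. -/
theorem exists_potentials_of_forall_perm {ι : Type*} [Fintype ι] [DecidableEq ι] [Nonempty ι]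
    {cost : ι → ι → ℝ} {c c' : ℝ} (hc : ∀ σ : Equiv.Perm ι, c ≤ ∑ t, cost t (σ t)) (hc' : c' < c) :
    ∃ α β : ι → ℝ, (∀ t h, α t + β h ≤ cost t h) ∧ c' < ∑ t, α t + ∑ h, β h := by
  set n : ℝ := (Fintype.card ι : ℝ) with hn
  have hn0 : 0 < n := by simp [hn, Fintype.card_pos]
  -- `Φ` records both marginals and the cost of a weight matrix, and `B` asks for uniform marginals
  -- and cost at most `c' / n`.
  let Φ : (ι × ι → ℝ) →ₗ[ℝ] (ι → ℝ) × (ι → ℝ) × ℝ :=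
    { toFun := fun p => (fun t => ∑ h, p (t, h), fun h => ∑ t, p (t, h),
        ∑ t, ∑ h, p (t, h) * cost t h)
      map_add' := fun p q => by
        ext <;> simp [Finset.sum_add_distrib, add_mul]
      map_smul' := fun a p => by
        ext <;> simp [Finset.mul_sum, mul_assoc] }
  have hΦ : Continuous Φ := LinearMap.continuous_of_finiteDimensional Φ
  let B : Set ((ι → ℝ) × (ι → ℝ) × ℝ) :=
    {z | z.1 = (fun _ => n⁻¹) ∧ z.2.1 = (fun _ => n⁻¹) ∧ z.2.2 ≤ c' / n}
  have hBconv : Convex ℝ B := by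
    rintro x ⟨hx1, hx2, hx3⟩ y ⟨hy1, hy2, hy3⟩ a b ha hb hab
    refine ⟨?_, ?_, ?_⟩
    · funext t
      simp [hx1, hy1, ← add_mul, hab]
    · funext t
      simp [hx2, hy2, ← add_mul, hab]
    · have h1 := mul_le_mul_of_nonneg_left hx3 ha
      have h2 := mul_le_mul_of_nonneg_left hy3 hb
      have h3 : a * (c' / n) + b * (c' / n) = c' / n := by rw [← add_mul, hab, one_mul]
      simp only [Prod.snd_add, Prod.smul_snd, smul_eq_mul]
      linarith
  have hBclosed : IsClosed B :=
    (isClosed_eq continuous_fst continuous_const).inter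
      ((isClosed_eq (continuous_fst.comp continuous_snd) continuous_const).inter
        (isClosed_le (continuous_snd.comp continuous_snd) continuous_const))
  -- A common point, scaled by `n`, would be a doubly stochastic matrix of cost at most `c' < c`. By
  -- Birkhoff's theorem it is a convex combination of permutation matrices, each costing at least
  -- `c`.
  have hdisj : Disjoint (Φ '' stdSimplex ℝ (ι × ι)) B := by
    rw [Set.disjoint_left]
    rintro _ ⟨p, hp, rfl⟩ ⟨h1, h2, h3⟩
    let A : Matrix ι ι ℝ := Matrix.of fun t h => n * p (t, h)
    have hA : A ∈ doublyStochastic ℝ ι := by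
      rw [mem_doublyStochastic_iff_sum]
      refine ⟨fun t h => mul_nonneg hn0.le (hp.1 _), fun t => ?_, fun h => ?_⟩
      · have := congrFun h1 t
        simp only [Φ, LinearMap.coe_mk, AddHom.coe_mk] at this
        simp only [A, Matrix.of_apply, ← Finset.mul_sum, this, mul_inv_cancel₀ hn0.ne']
      · have := congrFun h2 h
        simp only [Φ, LinearMap.coe_mk, AddHom.coe_mk] at this
        simp only [A, Matrix.of_apply, ← Finset.mul_sum, this, mul_inv_cancel₀ hn0.ne']
    have hlin : IsLinearMap ℝ fun M : Matrix ι ι ℝ => ∑ t, ∑ h, M t h * cost t h :=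
      { map_add := fun M M' => by simp [Finset.sum_add_distrib, add_mul]
        map_smul := fun a M => by simp [Finset.mul_sum, mul_assoc] }
    have hsub : (doublyStochastic ℝ ι : Set (Matrix ι ι ℝ)) ⊆
        {M | c ≤ ∑ t, ∑ h, M t h * cost t h} := by
      rw [doublyStochastic_eq_convexHull_permMatrix]
      refine convexHull_min ?_ (convex_halfSpace_ge hlin c)
      rintro _ ⟨σ, rfl⟩
      simpa [Equiv.Perm.permMatrix, PEquiv.toMatrix_apply] using hc σ
    have h4 : c ≤ ∑ t, ∑ h, n * p (t, h) * cost t h := hsub hA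
    simp only [mul_assoc, ← Finset.mul_sum] at h4
    simp only [Φ, LinearMap.coe_mk, AddHom.coe_mk] at h3
    rw [le_div_iff₀' hn0] at h3
    linarith
  obtain ⟨f, u, v, hfu, huv, hfv⟩ := geometric_hahn_banach_compact_closed
    ((convex_stdSimplex ℝ (ι × ι)).linear_image Φ)
    ((isCompact_stdSimplex ℝ (ι × ι)).image hΦ) hBconv hBclosed hdisj
  let φ : ι → ℝ := fun t => f (Pi.single t 1, 0, 0)
  let ψ : ι → ℝ := fun h => f (0, Pi.single h 1, 0)
  let l : ℝ := f (0, 0, 1)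
  have hf : ∀ x y z, f (x, y, z) = ∑ t, x t * φ t + ∑ h, y h * ψ h + z * l := by
    intro x y z
    have h : (x, y, z) = ∑ t, x t • ((Pi.single t 1, 0, 0) : (ι → ℝ) × (ι → ℝ) × ℝ) +
        ∑ h, y h • ((0, Pi.single h 1, 0) : (ι → ℝ) × (ι → ℝ) × ℝ) +
        z • ((0, 0, 1) : (ι → ℝ) × (ι → ℝ) × ℝ) := by
      ext <;> simp [Prod.fst_sum, Prod.snd_sum, Finset.sum_apply, Pi.single_apply]
    rw [h]
    simp only [map_add, map_sum, map_smul, smul_eq_mul, φ, ψ, l]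
  have hub : ∀ t h, φ t + ψ h + cost t h * l < u := by
    intro t h
    have h1 := hfu _ ⟨Pi.single (t, h) 1, single_mem_stdSimplex ℝ (t, h), rfl⟩
    have h2 : Φ (Pi.single (t, h) 1) = (Pi.single t 1, Pi.single h 1, cost t h) := by
      ext <;> simp [Φ, Pi.single_apply, Prod.ext_iff, ite_and, eq_comm]
    rw [h2, hf] at h1
    simpa [Pi.single_apply] using h1
  have hvb : ∀ z ≤ c' / n, v < n⁻¹ * ∑ t, φ t + n⁻¹ * ∑ h, ψ h + z * l := by
    intro z hz
    have h1 := hfv ((fun _ => n⁻¹), (fun _ => n⁻¹), z) ⟨rfl, rfl, hz⟩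
    rwa [hf, ← Finset.mul_sum, ← Finset.mul_sum] at h1
  set F := n⁻¹ * ∑ t, φ t + n⁻¹ * ∑ h, ψ h with hF
  have hFn : n * F = ∑ t, φ t + ∑ h, ψ h := by
    rw [hF]
    field_simp
  -- If `l = 0`, averaging over the diagonal contradicts the separation. If `l > 0`, the cost
  -- coordinate tends to -∞ inside `B`.
  have hl0 : l < 0 := by
    rcases lt_trichotomy l 0 with hl | hl | hl
    · exact hl
    · exfalso
      have h1 : v < F := by simpa [hl] using hvb (c' / n) le_rfl
      have h2 : ∀ t h, φ t + ψ h < u := fun t h => by simpa [hl] using hub t h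
      have h3 : ∑ t : ι, (φ t + ψ t) < ∑ t : ι, u :=
        Finset.sum_lt_sum_of_nonempty Finset.univ_nonempty fun t _ => h2 t t
      rw [Finset.sum_add_distrib, ← hFn, Finset.sum_const, Finset.card_univ, nsmul_eq_mul,
        ← hn] at h3
      have := lt_of_mul_lt_mul_left h3 hn0.le
      linarith
    · exfalso
      have h1 := hvb (min (c' / n) ((v - F) / l)) (min_le_left _ _)
      have h2 := mul_le_mul_of_nonneg_right (min_le_right (c' / n) ((v - F) / l)) hl.le
      rw [div_mul_cancel₀ _ hl.ne'] at h2
      linarith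
  -- The separating functional, with the level `u` absorbed in the first potential and the cost
  -- coefficient normalised.
  refine ⟨fun t => (φ t - u) / (-l), fun h => ψ h / (-l), fun t h => ?_, ?_⟩
  · rw [← add_div, div_le_iff₀ (by linarith)]
    linarith [hub t h]
  · rw [← Finset.sum_div, ← Finset.sum_div, ← add_div, lt_div_iff₀ (by linarith),
      Finset.sum_sub_distrib, Finset.sum_const, Finset.card_univ, nsmul_eq_mul, ← hn]
    have h1 := mul_lt_mul_of_pos_left (huv.trans (hvb (c' / n) le_rfl)) hn0
    rw [mul_add, hFn] at h1
    have h2 : n * (c' / n * l) = c' * l := by field_simp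
    linarith

/-- Probability vectors are approximated by the frequencies in lists. -/
theorem exists_list_frequencies {m n : ℕ} (hn : 0 < n) {w : ℕ → ℝ} (hw : ∀ k, 0 ≤ w k)
    (hw1 : ∑ k ∈ Finset.range m, w k = 1) :
    ∃ l : List ℕ, l.length = n ∧ ∀ (g : ℕ → ℝ) (C : ℝ), (∀ k, |g k - g 0| ≤ C) →
      |∑ k ∈ Finset.range m, w k * g k - (l.map g).sum / n| ≤ m * C / n := by
  have hn' : (0 : ℝ) < n := by exact_mod_cast hn
  let r : ℕ → ℕ := fun k => ⌊n * w k⌋₊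
  have hr : ∀ k, (r k : ℝ) ≤ n * w k := fun k => Nat.floor_le (mul_nonneg hn'.le (hw k))
  have hr' : ∀ k, n * w k < r k + 1 := fun k => Nat.lt_floor_add_one _
  have hsum : ∑ k ∈ Finset.range m, r k ≤ n := by
    have h : ((∑ k ∈ Finset.range m, r k : ℕ) : ℝ) ≤ n := by
      push_cast
      refine (Finset.sum_le_sum fun k _ => hr k).trans ?_
      rw [← Finset.mul_sum, hw1, mul_one]
    exact_mod_cast h
  have hflat : ∀ g : ℕ → ℝ, (((List.range m).flatMap fun k => List.replicate (r k) k).map g).sum =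
      ∑ k ∈ Finset.range m, r k * g k := by
    intro g
    clear hw1 hsum
    induction m with
    | zero => simp
    | succ m ih =>
      rw [List.range_succ, List.flatMap_append, List.map_append, List.sum_append, ih,
        Finset.sum_range_succ]
      simp
  have hlen : ((List.range m).flatMap fun k => List.replicate (r k) k).length =
      ∑ k ∈ Finset.range m, r k := by
    have := hflat fun _ => 1
    simp only [List.map_const', List.sum_replicate, nsmul_eq_mul, mul_one] at this
    exact_mod_cast this
  -- Multiplicities are rounded down and the deficit goes to the index 0. Each of the `m` indices
  -- thus adds an error of at most `C`.
  refine ⟨((List.range m).flatMap fun k => List.replicate (r k) k) ++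
    List.replicate (n - ∑ k ∈ Finset.range m, r k) 0, ?_, fun g C hg => ?_⟩
  · rw [List.length_append, hlen, List.length_replicate]
    omega
  · rw [List.map_append, List.sum_append, hflat, List.map_replicate, List.sum_replicate,
      nsmul_eq_mul, Nat.cast_sub hsum, le_div_iff₀ hn']
    have habs : ∀ y : ℝ, |y| * n = |y * n| := fun y => by rw [abs_mul, abs_of_pos hn']
    rw [habs, sub_mul, div_mul_cancel₀ _ hn'.ne', Finset.sum_mul]
    have h : ∑ k ∈ Finset.range m, w k * g k * n - (∑ k ∈ Finset.range m, (r k : ℝ) * g k +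
        ((n : ℝ) - (∑ k ∈ Finset.range m, r k : ℕ)) * g 0) =
        ∑ k ∈ Finset.range m, (n * w k - r k) * (g k - g 0) := by
      have h1 : (n : ℝ) = ∑ k ∈ Finset.range m, n * w k := by
        rw [← Finset.mul_sum, hw1, mul_one]
      have h2 : ((n : ℝ) - (∑ k ∈ Finset.range m, r k : ℕ)) * g 0 =
          ∑ k ∈ Finset.range m, (n * w k - r k) * g 0 := by
        rw [← Finset.sum_mul, Finset.sum_sub_distrib, ← h1]
        push_cast
        rfl
      rw [h2, ← Finset.sum_add_distrib, ← Finset.sum_sub_distrib]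
      exact Finset.sum_congr rfl fun k _ => by ring
    rw [h]
    refine (Finset.abs_sum_le_sum_abs _ _).trans ?_
    refine (Finset.sum_le_card_nsmul _ _ C fun k _ => ?_).trans (by simp)
    rw [abs_mul]
    have h1 : |n * w k - r k| ≤ 1 := abs_le.2 ⟨by linarith [hr k], by linarith [hr' k]⟩
    calc |n * w k - r k| * |g k - g 0| ≤ 1 * C :=
          mul_le_mul h1 (hg k) (abs_nonneg _) zero_le_one
      _ = C := one_mul C

end CompAnalysis

/-! ### Integral estimates and density of uniform distributions -/

namespace CompAnalysis

theorem integral_le_add_of_le_on {Y : Type*} [MeasurableSpace Y] {μ : Measure Y}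
    [IsProbabilityMeasure μ] {u v : Y → ℝ} (hu : Integrable u μ) (hv : Integrable v μ) {M e η : ℝ}
    (hM : 0 ≤ M) (he : 0 ≤ e) (h1 : ∀ y, u y ≤ v y + M) {A : Set Y} (h2 : ∀ y ∈ A, u y ≤ v y + e)
    (hA : 1 - η ≤ (μ A).toReal) : ∫ y, u y ∂μ ≤ ∫ y, v y ∂μ + e + M * η := by
  -- `A` need not be measurable; `B` contains it and is null measurable.
  let B : Set Y := {y | u y ≤ v y + e}
  have hB : NullMeasurableSet B μ := nullMeasurableSet_le hu.1.aemeasurable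
    (hv.1.aemeasurable.add_const e)
  have hAB : 1 - η ≤ μ.real B :=
    hA.trans (ENNReal.toReal_mono (measure_ne_top _ _) (measure_mono h2))
  have hBc : μ.real Bᶜ ≤ η := by
    rw [probReal_compl_eq_one_sub₀ hB]
    linarith
  have hint : Integrable (Bᶜ.indicator fun _ => M) μ := (integrable_const M).indicator₀ hB.compl
  calc ∫ y, u y ∂μ ≤ ∫ y, (v y + e) + Bᶜ.indicator (fun _ => M) y ∂μ := by
        refine integral_mono hu ((hv.add (integrable_const e)).add hint) fun y => ?_
        by_cases hy : y ∈ B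
        · have hy' : u y ≤ v y + e := hy
          simpa [Set.indicator_of_notMem (fun h : y ∈ Bᶜ => h hy)] using hy'
        · have := h1 y
          simp only [Set.mem_compl_iff, hy, not_false_eq_true, Set.indicator_of_mem]
          linarith
    _ = ∫ y, v y ∂μ + e + M * μ.real Bᶜ := by
        have hs : Integrable (fun y => v y + e) μ := hv.add (integrable_const e)
        rw [integral_add hs hint, integral_add hv (integrable_const e),
          integral_indicator₀ hB.compl, setIntegral_const]
        simp [mul_comm]
    _ ≤ ∫ y, v y ∂μ + e + M * η := by
        have := mul_le_mul_of_nonneg_left hBc hM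
        linarith

theorem integral_comp_simpleFunc {Y : Type*} [MeasurableSpace Y] (μ : Measure Y) [IsProbabilityMeasure μ] {m : ℕ}
    {φ : SimpleFunc Y ℕ} (hφ : ∀ x, φ x < m) (g : ℕ → ℝ) :
    ∫ x, g (φ x) ∂μ = ∑ k ∈ Finset.range m, μ.real (φ ⁻¹' {k}) * g k := by
  have h : (fun x => g (φ x)) =
      fun x => ∑ k ∈ Finset.range m, (φ ⁻¹' {k}).indicator (fun _ => g k) x := by
    funext x
    rw [Finset.sum_eq_single (φ x)]
    · simp
    · intro k _ hk
      simp [hk.symm]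
    · intro hx
      exact absurd (Finset.mem_range.2 (hφ x)) hx
  rw [h, integral_finsetSum _ fun k _ =>
    (integrable_const (g k)).indicator (φ.measurableSet_fiber k)]
  refine Finset.sum_congr rfl fun k _ => ?_
  rw [integral_indicator_const _ (φ.measurableSet_fiber k), smul_eq_mul]

section Density

variable {X : Type*} [MetricSpace X] [ComputableMetricSpace X] [BoundedSpace X]
  [MeasurableSpace X] [BorelSpace X]

/-- Send `x` to the nearest among the first ideal points and use dominated convergence, with the
diameter as bound. -/
theorem exists_simpleFunc_integral_dist_lt (μ : Measure X) [IsProbabilityMeasure μ] {ε : ℝ}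
    (hε : 0 < ε) : ∃ (m : ℕ) (φ : SimpleFunc X ℕ), (∀ x, φ x < m) ∧
      ∫ x, dist x (IdealPoints.idealPoint (φ x) : X) ∂μ < ε := by
  let φ : ℕ → SimpleFunc X ℕ := SimpleFunc.nearestPtInd (IdealPoints.idealPoint : ℕ → X)
  have hlim : Filter.Tendsto
      (fun m => ∫ x, dist x (IdealPoints.idealPoint (φ m x) : X) ∂μ) Filter.atTop
      (nhds (∫ _, (0 : ℝ) ∂μ)) := by
    refine tendsto_integral_of_dominated_convergence
      (fun _ => Metric.diam (Set.univ : Set X)) (fun m => ?_) (integrable_const _)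
      (fun m => Filter.Eventually.of_forall fun x => ?_) (Filter.Eventually.of_forall fun x => ?_)
    · have h : Measurable fun x => (IdealPoints.idealPoint (φ m x) : X) :=
        measurable_from_nat.comp (φ m).measurable
      have : TopologicalSpace.SeparableSpace X :=
        ⟨_, Set.countable_range _, ComputableMetricSpace.dense (X := X)⟩
      have : SecondCountableTopology X := UniformSpace.secondCountable_of_separable X
      exact (measurable_id.dist h).aestronglyMeasurable
    · rw [Real.norm_of_nonneg dist_nonneg]
      exact Metric.dist_le_diam_of_mem (Bornology.isBounded_univ.2 inferInstance) trivial trivial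
    · have h := SimpleFunc.tendsto_nearestPt
        (ComputableMetricSpace.dense (X := X) x)
      have h' := (tendsto_const_nhds (x := x)).dist h
      rw [dist_self] at h'
      exact h'
  rw [integral_zero] at hlim
  obtain ⟨m, hm⟩ := (hlim.eventually (gt_mem_nhds hε)).exists
  exact ⟨m + 1, φ m, fun x => Nat.lt_succ_of_le (SimpleFunc.nearestPtInd_le _ _ _), hm⟩

/-- Uniform distributions on finite lists of ideal points are dense; the length of the list can be
chosen to be a multiple of a given number. -/
theorem exists_list_forall_W1_lt (μ : ProbabilityMeasure X) {W : ℕ} (hW : 0 < W) {ε : ℝ}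
    (hε : 0 < ε) : ∃ (N : ℕ) (l : List ℕ), 0 < N ∧ l.length = N * W ∧
      ∀ l' : List ℕ, l'.Perm l → ∀ j, weightList j = (l'.map fun a => (a, 0)) →
        W1 μ (IdealPoints.idealPoint j) < ε := by
  obtain ⟨m, φ, hφ, hd⟩ := exists_simpleFunc_integral_dist_lt (μ : Measure X) (half_pos hε)
  set Δ := Metric.diam (Set.univ : Set X)
  obtain ⟨N₀, hN₀⟩ := exists_nat_gt (m * Δ / (ε / 2))
  let N := N₀ + 1
  have hn : 0 < N * W := Nat.mul_pos (Nat.succ_pos _) hW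
  have hn' : (0 : ℝ) < (N * W : ℕ) := by exact_mod_cast hn
  obtain ⟨l, hl, hfreq⟩ := exists_list_frequencies hn
    (w := fun k => (μ : Measure X).real (φ ⁻¹' {k})) (m := m) (fun k => measureReal_nonneg) (by
      have := integral_comp_simpleFunc (μ : Measure X) hφ fun _ => 1
      simpa using this.symm)
  have hsmall : m * Δ / (N * W : ℕ) ≤ ε / 2 := by
    rw [div_lt_iff₀ (half_pos hε)] at hN₀
    rw [div_le_iff₀ hn']
    have h1 : (N₀ : ℝ) ≤ (N * W : ℕ) := by
      have : N₀ ≤ N * W := (Nat.le_succ N₀).trans (Nat.le_mul_of_pos_right _ hW)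
      exact_mod_cast this
    have h2 := mul_le_mul_of_nonneg_right h1 (half_pos hε).le
    linarith
  refine ⟨N, l, Nat.succ_pos _, hl, fun l' hl' j hj => ?_⟩
  refine lt_of_le_of_lt (W1_le (c := ∫ x, dist x (IdealPoints.idealPoint (φ x) : X)
    ∂(μ : Measure X) + ε / 2) fun f hf => ?_) (by linarith)
  change _ - ∫ x, f x ∂(idealMeasure X j) ≤ _
  rw [integral_idealMeasure_of_uniform hj, (hl'.map _).sum_eq, hl'.length_eq, hl]
  have h1 := (abs_le.1 (hfreq (fun k => f (IdealPoints.idealPoint k)) Δ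
    fun k => abs_sub_le_diam hf _ _)).2
  rw [← integral_comp_simpleFunc (μ : Measure X) hφ
    fun k => f (IdealPoints.idealPoint k)] at h1
  have : TopologicalSpace.SeparableSpace X :=
    ⟨_, Set.countable_range _, ComputableMetricSpace.dense (X := X)⟩
  have : SecondCountableTopology X := UniformSpace.secondCountable_of_separable X
  have hm : Measurable fun x => (IdealPoints.idealPoint (φ x) : X) :=
    measurable_from_nat.comp φ.measurable
  have hi1 : Integrable (fun x => f (IdealPoints.idealPoint (φ x) : X)) (μ : Measure X) :=
    integrable_comp_of_aemeasurable hm.aemeasurable hf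
  have hi2 : Integrable (fun x => dist x (IdealPoints.idealPoint (φ x) : X)) (μ : Measure X) := by
    refine Integrable.of_bound (measurable_id.dist hm).aestronglyMeasurable Δ
      (Filter.Eventually.of_forall fun x => ?_)
    rw [Real.norm_of_nonneg dist_nonneg]
    exact Metric.dist_le_diam_of_mem (Bornology.isBounded_univ.2 inferInstance) trivial trivial
  have h2 : ∫ x, f x ∂(μ : Measure X) ≤ ∫ x, f (IdealPoints.idealPoint (φ x) : X) +
      dist x (IdealPoints.idealPoint (φ x) : X) ∂(μ : Measure X) := by
    refine integral_mono (hf.integrable_of_boundedSpace _) (hi1.add hi2) fun x => ?_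
    have h := hf.dist_le_mul x (IdealPoints.idealPoint (φ x))
    rw [Real.dist_eq, NNReal.coe_one, one_mul] at h
    change f x ≤ f (IdealPoints.idealPoint (φ x)) + dist x (IdealPoints.idealPoint (φ x))
    linarith [(abs_le.1 h).2]
  rw [integral_add hi1 hi2] at h2
  linarith

end Density

/-! ### Uniform continuity off a small set, and least certified radii -/

section Completeness

variable {X : Type*} [MetricSpace X] [ComputableMetricSpace X]

/-- The points `x` such that, whenever `T x` is in one of the balls of radius `(k + 1) / (K + 1)`,
`k < M * (K + 1)`, with centre in the list `l`, this is seen from a ball around `x` with a margin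
of `2 / (R + 1)`. -/
def uniformPoints (T : X → X) (C : Set X) (E : Set (ℕ × ℕ)) (l : List ℕ) (M K R : ℕ) : Set X :=
  {x ∈ C | ∀ c ∈ l, ∀ k < M * (K + 1), T x ∈ idealBall X (Nat.pair c (Nat.pair k K)) →
    ∃ i, (Nat.pair c (Nat.pair k K), i) ∈ E ∧
      dist x (IdealPoints.idealPoint i.unpair.1) + 2 / (R + 1) < (posRatNum i.unpair.2 : ℝ)}

theorem monotone_uniformPoints (T : X → X) (C : Set X) (E : Set (ℕ × ℕ)) (l : List ℕ) (M K : ℕ) :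
    Monotone (uniformPoints T C E l M K) := by
  rintro R R' hR x ⟨hx, h⟩
  refine ⟨hx, fun c hc k hk hT => ?_⟩
  obtain ⟨i, hi, hlt⟩ := h c hc k hk hT
  refine ⟨i, hi, lt_of_le_of_lt ?_ hlt⟩
  have : (2 : ℝ) / (R' + 1) ≤ 2 / (R + 1) := by
    have : (R : ℝ) ≤ R' := by exact_mod_cast hR
    gcongr
  linarith

/-- At a given point only finitely many balls are to be certified, and each admits a positive
margin. -/
theorem iUnion_uniformPoints {T : X → X} {C : Set X} {E : Set (ℕ × ℕ)}
    (hE : ∀ n, T ⁻¹' idealBall X n ∩ C = (⋃ l ∈ {l | (n, l) ∈ E}, idealBall X l) ∩ C)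
    (l : List ℕ) (M K : ℕ) : ⋃ R, uniformPoints T C E l M K R = C := by
  refine Set.Subset.antisymm (Set.iUnion_subset fun R => Set.sep_subset _ _) fun x hx => ?_
  have hlim : Filter.Tendsto (fun R : ℕ => (2 : ℝ) / ((R : ℝ) + 1)) Filter.atTop (nhds 0) :=
    Filter.Tendsto.div_atTop tendsto_const_nhds
      (Filter.tendsto_atTop_add_const_right _ _ tendsto_natCast_atTop_atTop)
  have h : ∀ᶠ R : ℕ in Filter.atTop, ∀ c ∈ {c | c ∈ l}, ∀ k ∈ Set.Iio (M * (K + 1)),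
      T x ∈ idealBall X (Nat.pair c (Nat.pair k K)) →
      ∃ i, (Nat.pair c (Nat.pair k K), i) ∈ E ∧
      dist x (IdealPoints.idealPoint i.unpair.1) + 2 / (R + 1) < (posRatNum i.unpair.2 : ℝ) := by
    rw [Filter.eventually_all_finite (List.finite_toSet l)]
    intro c _
    rw [Filter.eventually_all_finite (Set.finite_Iio _)]
    intro k _
    by_cases hT : T x ∈ idealBall X (Nat.pair c (Nat.pair k K))
    · have hmem := (hE _).subset (show x ∈ T ⁻¹' idealBall X _ ∩ C from ⟨hT, hx⟩)
      obtain ⟨i, hi, hxi⟩ := Set.mem_iUnion₂.1 hmem.1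
      have hpos : 0 < (posRatNum i.unpair.2 : ℝ) - dist x (IdealPoints.idealPoint i.unpair.1) :=
        sub_pos.2 hxi
      filter_upwards [hlim.eventually (gt_mem_nhds hpos)] with R hR _
      exact ⟨i, hi, by linarith⟩
    · exact Filter.Eventually.of_forall fun R hT' => absurd hT' hT
  obtain ⟨R, hR⟩ := h.exists
  exact Set.mem_iUnion.2 ⟨R, hx, fun c hc k hk => hR c hc k hk⟩

theorem exists_entryValid (E : Set (ℕ × ℕ)) (M R K a c : ℕ) :
    ∃ k, EntryValid X E M R K (a, c, k) :=
  ⟨M * (K + 1), Or.inr (Nat.le_succ _)⟩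

open Classical in
/-- The least `k` for which the entry `(a, c, k)` is valid. -/
noncomputable def leastEntry (X : Type*) [MetricSpace X] [ComputableMetricSpace X]
    (E : Set (ℕ × ℕ)) (M R K a c : ℕ) : ℕ :=
  Nat.find (exists_entryValid (X := X) E M R K a c)

theorem entryValid_leastEntry (E : Set (ℕ × ℕ)) (M R K a c : ℕ) :
    EntryValid X E M R K (a, c, leastEntry X E M R K a c) := by
  classical
  exact Nat.find_spec (exists_entryValid (X := X) E M R K a c)

theorem leastEntry_le {E : Set (ℕ × ℕ)} {M R K a c k : ℕ}
    (h : EntryValid X E M R K (a, c, k)) : leastEntry X E M R K a c ≤ k := by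
  classical
  exact Nat.find_min' (exists_entryValid (X := X) E M R K a c) h

theorem leastEntry_div_le {E : Set (ℕ × ℕ)} {M : ℕ} (hM : 0 < M) (R K a c : ℕ) :
    ((leastEntry X E M R K a c : ℝ) + 1) / (K + 1) ≤ M := by
  have hpos : 0 < M * (K + 1) := Nat.mul_pos hM (Nat.succ_pos _)
  have h : leastEntry X E M R K a c ≤ M * (K + 1) - 1 :=
    leastEntry_le (Or.inr (by simp only; omega))
  have h' : leastEntry X E M R K a c + 1 ≤ M * (K + 1) := by omega
  rw [div_le_iff₀ (by positivity)]
  exact_mod_cast h'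

/-- Rounding `d(T x, s_c)` up to the grid costs at most `1 / (K + 1)`. Of the margin `2 / (R + 1)`
at `x`, one half pays for the passage to `s_a` and the other for the ball around `s_a`. -/
theorem leastEntry_div_le_dist {T : X → X} {C : Set X} {E : Set (ℕ × ℕ)} {M : ℕ} (hM : 0 < M)
    {l : List ℕ} {R K a c : ℕ} (hc : c ∈ l) {x : X} (hx : x ∈ uniformPoints T C E l M K R)
    (hxa : dist x (IdealPoints.idealPoint a) < 1 / (R + 1)) :
    ((leastEntry X E M R K a c : ℝ) + 1) / (K + 1) ≤
      dist (T x) (IdealPoints.idealPoint c) + 1 / (K + 1) := by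
  have hK : (0 : ℝ) < K + 1 := by positivity
  set d := dist (T x) (IdealPoints.idealPoint c : X)
  let k := ⌊(K + 1) * d⌋₊
  have hk : (k : ℝ) ≤ (K + 1) * d := Nat.floor_le (mul_nonneg hK.le dist_nonneg)
  have hk' : (K + 1) * d < k + 1 := Nat.lt_floor_add_one _
  rcases lt_or_ge k (M * (K + 1)) with hkM | hkM
  · have hT : T x ∈ idealBall X (Nat.pair c (Nat.pair k K)) := by
      simp only [idealBall, posRatNum, Nat.unpair_pair, Set.mem_ofPred_eq]
      push_cast
      rw [lt_div_iff₀' hK]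
      exact hk'
    obtain ⟨i, hi, hlt⟩ := hx.2 c hc k hkM hT
    have hval : EntryValid X E M R K (a, c, k) := by
      refine Or.inl ⟨i, hi, ?_⟩
      have h1 := dist_triangle_left (IdealPoints.idealPoint a : X)
        (IdealPoints.idealPoint i.unpair.1) x
      have h2 : (2 : ℝ) / (R + 1) = 1 / (R + 1) + 1 / (R + 1) := by ring
      simp only
      linarith
    have h1 : (leastEntry X E M R K a c : ℝ) ≤ k := by exact_mod_cast leastEntry_le hval
    rw [← sub_le_iff_le_add, ← sub_div, add_sub_cancel_right, div_le_iff₀' hK]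
    linarith
  · have h1 : ((M * (K + 1) : ℕ) : ℝ) ≤ k := by exact_mod_cast hkM
    push_cast at h1
    have h2 : (M : ℝ) ≤ d := by
      refine le_of_mul_le_mul_left (a := (K : ℝ) + 1) ?_ hK
      linarith
    have h3 : (0 : ℝ) < 1 / (K + 1) := by positivity
    linarith [leastEntry_div_le (X := X) (E := E) hM R K a c]

end Completeness

end CompAnalysis

namespace CompAnalysis

/-! ### Completeness of transport plans and the main theorem -/

section

variable {X : Type*} [MetricSpace X] [ComputableMetricSpace X] [BoundedSpace X]
  [MeasurableSpace X] [BorelSpace X]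

/-- Dual potentials for the transport from a uniform approximation of `μ` to an ideal measure
bound the distance of the latter to the push-forward of `μ` from below. -/
theorem sum_potentials_div_le {T : X → X} {C : Set X} {E : Set (ℕ × ℕ)} {M : ℕ} (hM : 0 < M)
    {μ : ProbabilityMeasure X} (hT : AEMeasurable T (μ : Measure X)) {l : List ℕ} {R K : ℕ}
    {η ε : ℝ} (hη : 1 - η ≤ ((μ : Measure X) (uniformPoints T C E l M K R)).toReal)
    {n : ℕ} (hn : 0 < n) {a z : Fin n → ℕ} (hz : ∀ h, z h ∈ l) {i N j : ℕ} (hN : N ≠ 0)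
    (hzi : repeatedAtoms i N = List.ofFn z) (haj : weightList j = (List.ofFn a).map fun a => (a, 0))
    (hj : W1 μ (IdealPoints.idealPoint j) ≤ ε) {α β : Fin n → ℝ}
    (hαβ : ∀ h t, β h + α t ≤ ((leastEntry X E M R K (a t) (z h) : ℝ) + 1) / (K + 1)) :
    (∑ h, β h + ∑ t, α t) / n ≤ W1 (transferOperator T μ) (IdealPoints.idealPoint i) +
      1 / (K + 1) + M * η + M * (R + 1) * ε := by
  have hR : (0 : ℝ) < R + 1 := by positivity
  have hl : List.finRange n ≠ [] := by
    rw [Ne, List.finRange_eq_nil_iff]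
    exact hn.ne'
  obtain ⟨f, hf, hfle, hfeq⟩ := exists_lipschitzWith_forall_le (K := 1)
    (h := fun (h : Fin n) (y : X) => dist y (IdealPoints.idealPoint (z h)) - β h)
    (fun h => LipschitzWith.of_dist_le_mul fun x y => by
      rw [Real.dist_eq, sub_sub_sub_cancel_right, NNReal.coe_one, one_mul]
      exact abs_dist_sub_le _ _ _) hl
  obtain ⟨g, hg, hgle, hgeq⟩ := exists_lipschitzWith_forall_le (K := (M * (R + 1) : NNReal))
    (h := fun (t : Fin n) (x : X) => M * (R + 1) * dist x (IdealPoints.idealPoint (a t)) - α t)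
    (fun t => LipschitzWith.of_dist_le_mul fun x y => by
      rw [Real.dist_eq, sub_sub_sub_cancel_right, ← mul_sub, abs_mul,
        abs_of_nonneg (by positivity)]
      push_cast
      exact mul_le_mul_of_nonneg_left (abs_dist_sub_le _ _ _) (by positivity)) hl
  have hall : ∀ x, -g x ≤ f (T x) + M := by
    intro x
    obtain ⟨t, -, ht⟩ := hgeq x
    obtain ⟨h, -, hh⟩ := hfeq (T x)
    have h1 : (0 : ℝ) ≤ M * (R + 1) * dist x (IdealPoints.idealPoint (a t)) := by positivity
    have h2 := dist_nonneg (x := T x) (y := IdealPoints.idealPoint (z h))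
    linarith [hαβ h t, leastEntry_div_le (X := X) (E := E) hM R K (a t) (z h)]
  -- Near the minimising source atom the cost is almost the true distance; away from it the
  -- Lipschitz penalty already exceeds `M`.
  have hon : ∀ x ∈ uniformPoints T C E l M K R, -g x ≤ f (T x) + 1 / (K + 1) := by
    intro x hx
    obtain ⟨t, -, ht⟩ := hgeq x
    obtain ⟨h, -, hh⟩ := hfeq (T x)
    rcases lt_or_ge (dist x (IdealPoints.idealPoint (a t))) (1 / (R + 1)) with hd | hd
    · have h1 : (0 : ℝ) ≤ M * (R + 1) * dist x (IdealPoints.idealPoint (a t)) := by positivity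
      linarith [hαβ h t, leastEntry_div_le_dist hM (hz h) hx hd]
    · have h1 : (M : ℝ) ≤ M * (R + 1) * dist x (IdealPoints.idealPoint (a t)) := by
        rw [div_le_iff₀' hR] at hd
        nlinarith [Nat.cast_nonneg (α := ℝ) M]
      have h2 := dist_nonneg (x := T x) (y := IdealPoints.idealPoint (z h))
      have h3 : (0 : ℝ) < 1 / (K + 1) := by positivity
      linarith [hαβ h t, leastEntry_div_le (X := X) (E := E) hM R K (a t) (z h)]
  have h1 := integral_le_add_of_le_on (hg.integrable_of_boundedSpace (μ : Measure X)).neg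
    (integrable_comp_of_aemeasurable hT hf) (Nat.cast_nonneg M)
    (by positivity : (0 : ℝ) ≤ 1 / (K + 1)) hall hon hη
  have h2 := (abs_le.1 (abs_integral_sub_le_mul_W1 μ
    (IdealPoints.idealPoint j : ProbabilityMeasure X) hg)).2
  change (∫ x, g x ∂(μ : Measure X)) - ∫ x, g x ∂(idealMeasure X j) ≤ _ at h2
  have h3 := (abs_le.1 (abs_integral_sub_le_W1 (transferOperator T μ)
    (IdealPoints.idealPoint i : ProbabilityMeasure X) hf)).2
  rw [integral_transferOperator hT hf.continuous] at h3
  change (∫ x, f (T x) ∂(μ : Measure X)) - ∫ x, f x ∂(idealMeasure X i) ≤ _ at h3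
  have hn' : (0 : ℝ) < n := by exact_mod_cast hn
  have h4 : ∫ x, g x ∂(idealMeasure X j) ≤ -((∑ t, α t) / n) := by
    rw [integral_idealMeasure_of_uniform haj, List.map_ofFn, List.sum_ofFn, List.length_ofFn,
      ← neg_div, ← Finset.sum_neg_distrib]
    refine div_le_div_of_nonneg_right (Finset.sum_le_sum fun t _ => ?_) hn'.le
    have := hgle t (List.mem_finRange t) (IdealPoints.idealPoint (a t))
    rwa [dist_self, mul_zero, zero_sub] at this
  have h5 : ∫ x, f x ∂(idealMeasure X i) ≤ -((∑ h, β h) / n) := by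
    rw [integral_idealMeasure_of_repeatedAtoms hN, hzi, List.map_ofFn, List.sum_ofFn,
      List.length_ofFn, ← neg_div, ← Finset.sum_neg_distrib]
    refine div_le_div_of_nonneg_right (Finset.sum_le_sum fun h _ => ?_) hn'.le
    have := hfle h (List.mem_finRange h) (IdealPoints.idealPoint (z h))
    rwa [dist_self, zero_sub] at this
  have h6 := mul_le_mul_of_nonneg_left hj (by positivity : (0 : ℝ) ≤ M * (R + 1))
  simp only [Pi.neg_apply, integral_neg] at h1
  push_cast at h2
  rw [add_div]
  linarith

theorem exists_isTransportPlan {T : X → X} {D : Set X} {E : Set (ℕ × ℕ)}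
    (hE : ∀ n, T ⁻¹' idealBall X n ∩ Dᶜ = (⋃ l ∈ {l | (n, l) ∈ E}, idealBall X l) ∩ Dᶜ)
    {M : ℕ} (hM : 0 < M) {μ : ProbabilityMeasure X} (hT : AEMeasurable T (μ : Measure X))
    (hμ : μ ∈ PMD D) {r : ℕ}
    (hr : transferOperator T μ ∈ idealBall (ProbabilityMeasure X) r) :
    ∃ j s L, IsTransportPlan X E M (r, j) s L ∧ μ ∈ idealBall (ProbabilityMeasure X) j := by
  set i := r.unpair.1 with hi
  set q : ℝ := (posRatNum r.unpair.2 : ℝ) with hq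
  set w := W1 (transferOperator T μ) (IdealPoints.idealPoint i) with hw
  have hwq : 0 < (q - w) / 8 := by
    have : w < q := hr
    linarith
  -- The contradiction below spends less than `5 e`: once each for `K` and `R`, twice for `P`, and
  -- once for the duality gap.
  set e := (q - w) / 8 with he
  have hM' : (0 : ℝ) < M := by exact_mod_cast hM
  obtain ⟨K, hK⟩ := exists_nat_one_div_lt hwq
  -- `N` is chosen only after `R` and `P`, so the target atoms are listed with `N = 1`; further
  -- repetition adds no new centres.
  obtain ⟨R, hR⟩ : ∃ R, 1 - e / M ≤
      ((μ : Measure X) (uniformPoints T Dᶜ E (repeatedAtoms i 1) M K R)).toReal := by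
    have h1 : (1 : ENNReal) ≤ ⨆ R,
        (μ : Measure X) (uniformPoints T Dᶜ E (repeatedAtoms i 1) M K R) := by
      rw [← (monotone_uniformPoints T Dᶜ E (repeatedAtoms i 1) M K).measure_iUnion,
        iUnion_uniformPoints hE]
      have h2 := measure_union_le (μ := (μ : Measure X)) D Dᶜ
      have h3 : (μ : Measure X) D = 0 := hμ
      rwa [Set.union_compl_self, measure_univ, h3, zero_add] at h2
    have h2 : ENNReal.ofReal (1 - e / M) < 1 := by
      rw [← ENNReal.ofReal_one, ENNReal.ofReal_lt_ofReal_iff one_pos]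
      have := div_pos hwq hM'
      linarith
    obtain ⟨R, hR⟩ := lt_iSup_iff.1 (h2.trans_le h1)
    exact ⟨R, (ENNReal.ofReal_le_iff_le_toReal (measure_ne_top _ _)).1 hR.le⟩
  have hR' : (0 : ℝ) < M * (R + 1) := by positivity
  obtain ⟨P, hP⟩ := exists_nat_one_div_lt (div_pos hwq hR')
  have hP' : M * (R + 1) * (1 / ((P : ℝ) + 1)) < e := by
    rwa [lt_div_iff₀' hR'] at hP
  obtain ⟨N, l, hN, hl, hlW⟩ := exists_list_forall_W1_lt μ (totalWeight_pos i)
    (Nat.one_div_pos_of_nat (α := ℝ) (n := P))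
  have hpos : 0 < N * totalWeight i := Nat.mul_pos hN (totalWeight_pos i)
  set n := N * totalWeight i with hn
  have hn' : (0 : ℝ) < n := by exact_mod_cast hpos
  obtain ⟨a, ha⟩ : ∃ a : Fin n → ℕ, List.ofFn a = l := by
    clear_value n
    subst hl
    exact ⟨l.get, List.ofFn_get l⟩
  obtain ⟨z, hz⟩ : ∃ z : Fin n → ℕ, List.ofFn z = repeatedAtoms i N := by
    have h : (repeatedAtoms i N).length = n := length_repeatedAtoms i N
    clear_value n
    subst h
    exact ⟨(repeatedAtoms i N).get, List.ofFn_get _⟩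
  have hzmem : ∀ h, z h ∈ repeatedAtoms i 1 := by
    intro h
    have h1 : z h ∈ repeatedAtoms i N := hz ▸ List.mem_ofFn.2 ⟨h, rfl⟩
    simp only [repeatedAtoms, List.mem_flatMap, List.mem_map, List.mem_range] at h1 ⊢
    obtain ⟨p, hp, -, -, hpz⟩ := h1
    exact ⟨p, hp, 0, by omega, hpz⟩
  have : Nonempty (Fin n) := ⟨⟨0, hpos⟩⟩
  let cost : Fin n → Fin n → ℝ := fun h t =>
    ((leastEntry X E M R K (a t) (z h) : ℝ) + 1) / (K + 1)
  obtain ⟨σ, hσ⟩ : ∃ σ : Equiv.Perm (Fin n),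
      ∑ h, cost h (σ h) < n * (q - M * (R + 1) * (1 / ((P : ℝ) + 1))) := by
    by_contra! hcon
    obtain ⟨β, α, hαβ, hsum⟩ := exists_potentials_of_forall_perm hcon
      (c' := n * (q - M * (R + 1) * (1 / ((P : ℝ) + 1)) - e))
      (mul_lt_mul_of_pos_left (by linarith) hn')
    obtain ⟨j, hj⟩ := exists_weightList_eq (l := (List.ofFn a).map fun a => (a, 0)) (by
      rw [Ne, List.map_eq_nil_iff, List.ofFn_eq_nil_iff]
      exact hpos.ne')
    have hbound := sum_potentials_div_le hM hT hR hpos hzmem hN.ne' hz.symm hj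
      (hlW _ (ha ▸ List.Perm.refl _) j hj).le hαβ
    rw [mul_div_cancel₀ _ hM'.ne', ← hw] at hbound
    rw [← lt_div_iff₀' hn'] at hsum
    linarith
  let L : List (ℕ × ℕ × ℕ) := List.ofFn fun h =>
    (a (σ h), z h, leastEntry X E M R K (a (σ h)) (z h))
  have hLlen : L.length = n := List.length_ofFn
  -- A plan lists its sources in the order of the targets. The permuted list names the same measure
  -- by another index, so the approximation of μ persists.
  obtain ⟨j, hj⟩ := exists_weightList_eq (l := (List.ofFn (a ∘ σ)).map fun a => (a, 0)) (by
    rw [Ne, List.map_eq_nil_iff, List.ofFn_eq_nil_iff]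
    exact hpos.ne')
  have hperm : (List.ofFn (a ∘ σ)).Perm l := ha ▸ Equiv.Perm.ofFn_comp_perm σ a
  refine ⟨Nat.pair j (Nat.pair 0 P), (N, R, K, P), L, ⟨?_, ?_, ?_, ?_, ?_⟩, ?_⟩
  · simp only [Nat.unpair_pair]
    rw [hj, List.map_ofFn, List.map_ofFn]
    rfl
  · simp only [Nat.unpair_pair]
  · change _ = repeatedAtoms i N
    rw [← hz, List.map_ofFn]
    rfl
  · simp only
    rw [cost_lt_iff (hLlen ▸ hpos), hLlen, ← hq]
    have hS : (((L.map fun t => t.2.2 + 1).sum : ℕ) : ℝ) / (K + 1) = ∑ h, cost h (σ h) := by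
      rw [List.map_ofFn, List.sum_ofFn, Nat.cast_sum, Finset.sum_div]
      refine Finset.sum_congr rfl fun h _ => ?_
      simp [cost]
    rw [hS, ← lt_sub_iff_add_lt, div_lt_iff₀' hn']
    rwa [mul_one_div] at hσ
  · intro t ht
    obtain ⟨h, rfl⟩ := List.mem_ofFn.1 ht
    exact entryValid_leastEntry E M R K _ _
  · change W1 μ (IdealPoints.idealPoint (Nat.pair j (Nat.pair 0 P)).unpair.1) <
      (posRatNum (Nat.pair j (Nat.pair 0 P)).unpair.2 : ℝ)
    simp only [Nat.unpair_pair, posRatNum]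
    simpa using hlW _ hperm j hj

theorem ComputableMapOn.transferOperator {T : X → X} {D : Set X} (hT : ComputableMapOn T Dᶜ) :
    ComputableMapOn (transferOperator T) (PMD D) := by
  have hTm : ∀ μ ∈ PMD D, AEMeasurable T (μ : Measure X) := fun μ hμ => hT.aemeasurable hμ
  obtain ⟨U, ⟨E, hE, hU⟩, hTU⟩ := hT
  have hpre : ∀ n, T ⁻¹' idealBall X n ∩ Dᶜ =
      (⋃ l ∈ {l | (n, l) ∈ E}, idealBall X l) ∩ Dᶜ := fun n => by rw [hTU, hU]
  obtain ⟨M₀, hM₀⟩ := exists_nat_gt (Metric.diam (Set.univ : Set X))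
  have hdist : ∀ x y : X, dist x y ≤ (M₀ + 1 : ℕ) := by
    intro x y
    have := Metric.dist_le_diam_of_mem (Bornology.isBounded_univ.2 inferInstance)
      (Set.mem_univ x) (Set.mem_univ y)
    push_cast
    linarith
  let F : Set (ℕ × ℕ) := {p | ∃ s L, IsTransportPlan X E (M₀ + 1) p s L}
  refine ⟨fun n => ⋃ j ∈ {j | (n, j) ∈ F}, idealBall (ProbabilityMeasure X) j,
    ⟨F, rePred_exists_isTransportPlan hE _, fun n => rfl⟩, fun n => ?_⟩
  ext μ
  simp only [Set.mem_inter_iff, Set.mem_preimage, Set.mem_iUnion, and_congr_left_iff]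
  intro hμ
  constructor
  · intro h
    obtain ⟨j, s, L, hL, hj⟩ := exists_isTransportPlan hpre (Nat.succ_pos M₀) (hTm μ hμ) hμ h
    exact ⟨j, ⟨s, L, hL⟩, hj⟩
  · rintro ⟨j, ⟨s, L, hL⟩, hj⟩
    exact hL.transferOperator_mem hpre hdist (hTm μ hμ) hμ hj

end

end CompAnalysis

theorem theorem4p1 {X : Type*} [MetricSpace X] [ComputableMetricSpace X] [BoundedSpace X]
    [MeasurableSpace X] [BorelSpace X] (T : X → X) :
    (∀ D : Set X, ComputableMapOn T Dᶜ →
      (∀ μ ∈ PMD D, AEMeasurable T (μ : MeasureTheory.Measure X)) ∧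
        ComputableMapOn (transferOperator T) (PMD D)) ∧
    (ComputableMap T → Measurable T ∧ ComputableMap (transferOperator T)) := by
  refine ⟨fun D hT => ⟨fun μ hμ => hT.aemeasurable hμ, hT.transferOperator⟩,
    fun hT => ⟨hT.measurable, ComputableMapOn.computableMap ?_⟩⟩
  have hT' : ComputableMapOn T (∅ : Set X)ᶜ := by
    rw [Set.compl_empty]
    exact hT.computableMapOn_univ
  have h : PMD (∅ : Set X) = Set.univ := Set.eq_univ_of_forall fun μ => measure_empty
  rw [← h]
  exact hT'.transferOperator
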